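/- Let $R>1$ and $\theta\in(-\pi/2,\pi/2)$, $\theta\neq 0$, satisfy $1<R\cos\theta\le 3/2$. Put $a=Re^{i\theta}$, $b=1-a$ (so $-1/2\le \operatorname{Re} b<0$), $J(\zeta)=\frac12(\zeta+\frac1\zeta)$ and $\Psi(w)=J(aw+b)$, and let $K=\mathbb C\setminus\Psi(\{|w|>1\})$ be the corresponding Joukowski airfoil. Let $\Phi:\mathbb C\setminus K\to\{|w|>1\}$ be a conformal map with $\Phi(\infty)=\infty$ (it is unique up to multiplication by a constant of modulus one; for instance $\Phi=\Psi^{-1}$, or the map normalized by $\Phi'(\infty)>0$), and let $F_n$ be the Faber polynomials of $K$, i.e. the polynomials with $$F_n(z)=\Phi(z)^n+O(1/z),\qquad z\to\infty .$$ For $n\ge1$ let $\mu_n=\frac1n\sum_{j=1}^n\delta_{z_j^{(n)}}$, where $z_1^{(n)},\dots,z_n^{(n)}$ are the zeros of $F_n$ counted with multiplicity. Let $$V(z)=b^2+1-2bz,\qquad U(z)=\frac{z-b}{V(z)^{1/2}},\qquad \mathcal A=\{z\in\mathbb C:\ V(z)\ne0,\ U(z)\in[-1,1]\},$$ where $V^{1/2}$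 is the principal branch of the square root; it satisfies $V(1)^{1/2}=1-b$, and its branch cut $\{z: V(z)\in(-\infty,0]\}$, a ray from $c=\frac12(b+\frac1b)$ to infinity, does not meet $\mathcal A$. Let $\mu_{[-1,1]}=\frac1\pi\frac{dx}{\sqrt{1-x^2}}$ be the equilibrium measure of $[-1,1]$. Then $U$ restricts to a bijection of $\mathcal A$ onto $[-1,1]$, whose inverse is denoted by $U^{-1}:[-1,1]\to\mathcal A$, and: 1. all zeros of $F_n$ approach $\mathcal A$ as $n\to\infty$: for every $\varepsilon>0$ there is $N$ such that for all $n\ge N$ every zero of $F_n$ has distance less than $\varepsilon$ from $\mathcal A$; 2. $\displaystyle\lim_{n\to\infty}\mu_n=(U^{-1})_*(\mu_{[-1,1]})$ weak-*, that is, $\int f\,d\mu_n\to\int_{[-1,1]} f(U^{-1}(x))\,d\mu_{[-1,1]}(x)$ for every bounded continuous $f:\mathbb C\to\mathbb R$. -/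

import Mathlib

open Filter Topology MeasureTheory Polynomial
open scoped NNReal

namespace Joukowski

noncomputable section

/-- `Φ` is a conformal map of the unbounded domain `ℂ \ K` onto `{|w| > 1}` with `Φ(∞) = ∞`.
Such a map is unique up to a rotation `Φ ↦ ωΦ`, `|ω| = 1`; neither the normalization `Φ'(∞) > 0`
nor any other choice of `ω` is imposed, so every choice is covered. -/
structure IsExteriorMap (K : Set ℂ) (Φ : ℂ → ℂ) : Prop where
  differentiableOn : DifferentiableOn ℂ Φ Kᶜ
  bijOn : Set.BijOn Φ Kᶜ {w : ℂ | 1 < ‖w‖}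
  tendsto_infty : Tendsto Φ (Bornology.cobounded ℂ) (Bornology.cobounded ℂ)

/-- `F` is the `n`-th Faber polynomial for the exterior map `Φ`:
`F(z) = Φ(z) ^ n + O(1/z)` as `z → ∞`. -/
def IsFaberPolynomial (Φ : ℂ → ℂ) (n : ℕ) (F : ℂ[X]) : Prop :=
  (fun z : ℂ => F.eval z - Φ z ^ n) =O[Bornology.cobounded ℂ] (fun z : ℂ => z⁻¹)

/-- The coefficient `a = R e^{iθ}`. -/
def coeffA (R θ : ℝ) : ℂ := (R : ℂ) * Complex.exp ((θ : ℂ) * Complex.I)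

/-- The coefficient `b = 1 - a = 1 - R e^{iθ}`. -/
def coeffB (R θ : ℝ) : ℂ := 1 - coeffA R θ

/-- The Joukowski map `J(ζ) = (ζ + 1/ζ) / 2`. -/
def joukowskiMap (ζ : ℂ) : ℂ := (ζ + 1 / ζ) / 2

/-- `Ψ = J ∘ T` with `T(w) = a w + b`. -/
def psi (R θ : ℝ) (w : ℂ) : ℂ := joukowskiMap (coeffA R θ * w + coeffB R θ)

/-- The Joukowski airfoil: the complement of `Ψ({|w| > 1})`. -/
def airfoil (R θ : ℝ) : Set ℂ := (psi R θ '' {w : ℂ | 1 < ‖w‖})ᶜ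

/-- `V(z) = b² + 1 - 2bz`. -/
def V (b z : ℂ) : ℂ := b ^ 2 + 1 - 2 * b * z

/-- `W(z) = z - b`. -/
def W (b z : ℂ) : ℂ := z - b

/-- The principal branch of `V(z)^{1/2}`. It is holomorphic off the ray `{V(z) ∈ (-∞, 0]}`, which
joins the zero `c = (b + 1/b)/2` of `V` to infinity. By `sqrtV_one` it is the branch with
`V(1)^{1/2} = 1 - b`, and by `V_mem_slitPlane_of_mem_arc` the ray avoids the arc `arc b`
when `-1 < Re b < 0`. -/
def sqrtV (b z : ℂ) : ℂ := V b z ^ (1 / 2 : ℂ)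

/-- `U(z) = W(z) / V(z)^{1/2}`; meaningful where `V(z) ≠ 0`. -/
def U (b z : ℂ) : ℂ := W b z / sqrtV b z

/-- The arc of all `z` with `U(z) ∈ [-1, 1]`. The zero of `V`, where `U` is undefined,
is excluded. -/
def arc (b : ℂ) : Set ℂ := {z : ℂ | V b z ≠ 0 ∧ ∃ x ∈ Set.Icc (-1 : ℝ) 1, U b z = (x : ℂ)}

/-- The inverse of the restriction of `U` to `arc b`, as a map on `[-1, 1]`. -/
def Uinv (b : ℂ) (x : ℝ) : ℂ := Function.invFunOn (U b) (arc b) (x : ℂ)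

/-- The finite measure `dx / √(1 - x²)` on `[-1, 1]`. -/
def chebyshevMeasure : FiniteMeasure ℝ :=
  ⟨Polynomial.Chebyshev.measureT,
    (integrable_const_iff_isFiniteMeasure (one_ne_zero (α := ℝ))).1
      (Polynomial.Chebyshev.integrable_measureT continuousOn_const)⟩

/-- The equilibrium measure `dx / (π √(1 - x²))` of `[-1, 1]`. -/
def equilibriumMeasure : FiniteMeasure ℝ := NNReal.pi⁻¹ • chebyshevMeasure

/-- The normalized counting measure `(1/n) ∑ δ_{z_j}` of the zeros of `F`, listed with
multiplicity. -/
def zeroMeasure (n : ℕ) (F : ℂ[X]) : FiniteMeasure ℂ :=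
  (n : ℝ≥0)⁻¹ • (F.roots.map fun z => (diracProba z).toFiniteMeasure).sum

theorem sqrtV_sq (b z : ℂ) : sqrtV b z ^ 2 = V b z := by
  unfold sqrtV
  rw [← Complex.cpow_nat_mul]
  norm_num

theorem sqrtV_re_nonneg (b z : ℂ) : 0 ≤ (sqrtV b z).re := by
  unfold sqrtV
  by_cases h : V b z = 0
  · simp [h]
  rw [Complex.cpow_def_of_ne_zero h, Complex.exp_re]
  have h1 := Complex.neg_pi_lt_log_im (V b z)
  have h2 := Complex.log_im_le_pi (V b z)
  have h3 : (Complex.log (V b z) * (1 / 2 : ℂ)).im = (Complex.log (V b z)).im / 2 := by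
    have : (1 / 2 : ℂ) = ((1 / 2 : ℝ) : ℂ) := by norm_num
    rw [this, Complex.im_mul_ofReal]
    ring
  rw [h3]
  exact mul_nonneg (Real.exp_pos _).le
    (Real.cos_nonneg_of_mem_Icc ⟨by linarith, by linarith⟩)

theorem sqrtV_one {b : ℂ} (hb : b.re < 0) : sqrtV b 1 = 1 - b := by
  have h : (sqrtV b 1 - (1 - b)) * (sqrtV b 1 + (1 - b)) = 0 := by
    have := sqrtV_sq b 1
    unfold V at this
    linear_combination this
  rcases mul_eq_zero.1 h with h | h
  · exact sub_eq_zero.1 h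
  · have h1 := congrArg Complex.re h
    have h2 := sqrtV_re_nonneg b 1
    simp at h1
    linarith

theorem V_mem_slitPlane_of_mem_arc {b z : ℂ} (hb : -1 < b.re) (hb' : b.re < 0)
    (hz : z ∈ arc b) : V b z ∈ Complex.slitPlane := by
  obtain ⟨hV, u, ⟨hu1, hu2⟩, hu⟩ := hz
  have hs := sqrtV_sq b z
  have hs0 : sqrtV b z ≠ 0 := by
    intro h0
    rw [h0] at hs
    exact hV (by rw [← hs]; norm_num)
  have hW : z = b + u * sqrtV b z := by
    unfold U W at hu
    rw [div_eq_iff hs0] at hu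
    linear_combination hu
  have hre := sqrtV_re_nonneg b z
  have key : sqrtV b z ^ 2 + 2 * b * u * sqrtV b z = 1 - b ^ 2 := by
    unfold V at hs
    linear_combination hs - 2 * b * hW
  generalize sqrtV b z = s at hs hs0 hre key
  rw [Complex.mem_slitPlane_iff]
  by_contra hcon
  push Not at hcon
  obtain ⟨hc1, hc2⟩ := hcon
  rw [← hs] at hc1 hc2
  have k1 := congrArg Complex.re key
  have k2 := congrArg Complex.im key
  simp [pow_two] at k1 k2 hc1 hc2
  have hs_re : s.re = 0 := by
    rcases mul_eq_zero.1 (show s.re * s.im = 0 by linarith) with h | h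
    · exact h
    · rw [h] at hc1
      nlinarith
  simp only [hs_re] at k1 k2
  have hq : u * s.im = -b.im := by
    have : b.re * (u * s.im + b.im) = 0 := by linarith
    rcases mul_eq_zero.1 this with h | h
    · exact absurd h hb'.ne
    · linarith
  have hq2 : b.im * b.im = (u * u) * (s.im * s.im) := by
    have : b.im = -(u * s.im) := by linarith
    rw [this]; ring
  have hb3 : b.im * (u * s.im) = -(b.im * b.im) := by rw [hq]; ring
  have : u * u ≤ 1 := by nlinarith
  nlinarith [mul_self_nonneg s.im, mul_le_mul_of_nonneg_right this (mul_self_nonneg s.im)]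

end

end Joukowski

namespace Joukowski

noncomputable section

/-! Write `z = (ζ + 1/ζ) / 2` and put `w₁ = ζ - b`, `w₂ = 1/ζ - b`. Then `w₁ + w₂ = 2 (z - b)` and
`w₁ w₂ = V(z)`, so `w₁ ^ n + w₂ ^ n` is a polynomial in `z`. At `z = Ψ(w)` with `ζ = a w + b` one
has `w₁ = a w` and `w₂ → -b` at infinity. By the Schwarz lemma `Φ(Ψ(w)) = ω w` with `|ω| = 1`, hence
`F_n = (ω / a) ^ n (w₁ ^ n + w₂ ^ n - (-b) ^ n)` (`IsFaberPolynomial.eq`).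

A zero thus balances three `n`-th powers, and for large `n` the largest modulus among `w₁, w₂, b`
cannot be isolated. The locus `|w₁| = |w₂|` lies in the arc (`mem_arc_of_norm_eq`). The term `b`
never wins: `|w₁|, |w₂| ≤ |b|` forces `ζ = -1` (`eq_neg_one_of_norm_le`, where `Re b ≥ -1/2`
enters). Compactness makes this uniform off a neighbourhood of the arc, which gives the first claim.

For the distribution, parametrize by `U = cos φ`, so that `w₁, w₂ = s e^{±iφ}` with `s = V ^ (1/2)`.
The zero equation becomes `2 cos (n φ) = (-b / s) ^ n`, whose right side is exponentially small away
from the endpoints `φ = 0, π`. Hence one zero lies near each Chebyshev node there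
(`exists_zero_near_chebyshevAngle`). Since `F_n` has at most `n` zeros, these are nearly all of
them, and averages over zeros become Riemann sums in `φ`. -/

/-! ### The explicit inverse of `U` on the arc. -/

theorem cpow_half_sq (z : ℂ) : (z ^ (1 / 2 : ℂ)) ^ 2 = z := by
  rw [← Complex.cpow_nat_mul]
  norm_num

theorem cpow_half_re_nonneg (z : ℂ) : 0 ≤ (z ^ (1 / 2 : ℂ)).re := by
  have h := sqrtV_re_nonneg 1 ((2 - z) / 2)
  unfold sqrtV V at h
  convert h using 3
  ring

theorem sq_cpow_half {s : ℂ} (hs : 0 < s.re) : (s ^ 2) ^ (1 / 2 : ℂ) = s := by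
  have h1 := cpow_half_re_nonneg (s ^ 2)
  rcases sq_eq_sq_iff_eq_or_eq_neg.1 (cpow_half_sq (s ^ 2)) with h | h
  · exact h
  · rw [h, Complex.neg_re] at h1
    linarith

/-- The discriminant of the quadratic equation `s ^ 2 + 2 b u s = 1 - b ^ 2`. -/
def arcDisc (b u : ℂ) : ℂ := 1 - (1 - u ^ 2) * b ^ 2

/-- The root of `s ^ 2 + 2 b u s = 1 - b ^ 2` that equals `V ^ (1 / 2)` at `U⁻¹ u`. -/
def arcSqrt (b u : ℂ) : ℂ := arcDisc b u ^ (1 / 2 : ℂ) - b * u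

/-- The inverse of `U`. -/
def arcPoint (b u : ℂ) : ℂ := b + u * arcSqrt b u

theorem arcSqrt_quadratic (b u : ℂ) :
    arcSqrt b u ^ 2 + 2 * b * u * arcSqrt b u = 1 - b ^ 2 := by
  have h := cpow_half_sq (arcDisc b u)
  unfold arcSqrt
  generalize arcDisc b u ^ (1 / 2 : ℂ) = d at *
  unfold arcDisc at h
  linear_combination h

theorem V_arcPoint (b u : ℂ) : V b (arcPoint b u) = arcSqrt b u ^ 2 := by
  unfold V arcPoint
  linear_combination -arcSqrt_quadratic b u

theorem U_arcPoint {b u : ℂ} (h : 0 < (arcSqrt b u).re) : U b (arcPoint b u) = u := by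
  have h0 : arcSqrt b u ≠ 0 := by
    rintro h'
    simp [h'] at h
  unfold U sqrtV W
  rw [V_arcPoint, sq_cpow_half h, arcPoint]
  field_simp
  ring

section Real

variable {b : ℂ} (hb : -(1 / 2) ≤ b.re) (hb' : b.re < 0) {x : ℝ} (hx : x ∈ Set.Icc (-1 : ℝ) 1)

include hb hb' hx

theorem arcDisc_re_ge : 1 - (1 - x ^ 2) * b.re ^ 2 ≤ (arcDisc b x).re := by
  have h : (arcDisc b x).re = 1 - (1 - x ^ 2) * (b.re ^ 2 - b.im ^ 2) := by
    have : (1 - (x : ℂ) ^ 2) = ((1 - x ^ 2 : ℝ) : ℂ) := by push_cast; rfl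
    rw [arcDisc, this, Complex.sub_re, Complex.re_ofReal_mul]
    simp [pow_two]
  rw [h]
  have : 0 ≤ 1 - x ^ 2 := by nlinarith [hx.1, hx.2]
  nlinarith [mul_nonneg this (sq_nonneg b.im)]

theorem arcDisc_mem_slitPlane : arcDisc b x ∈ Complex.slitPlane := by
  left
  have h := arcDisc_re_ge hb hb' hx
  have h1 : 0 ≤ 1 - x ^ 2 := by nlinarith [hx.1, hx.2]
  have h2 : b.re ^ 2 ≤ 1 / 4 := by nlinarith
  nlinarith [mul_nonneg h1 (sq_nonneg b.re), sq_nonneg x]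

/-- With `d` the square root, `(Re d)² ≥ Re (d²) ≥ 1 - (1 - x²)(Re b)² > x² (Re b)²`. This separates
the roots `±d - b x` of the quadratic by the sign of their real parts, so only `arcSqrt` can be a
principal square root. -/
theorem abs_mul_re_lt : |b.re * x| < (arcDisc b x ^ (1 / 2 : ℂ)).re := by
  have h := arcDisc_re_ge hb hb' hx
  have h1 := congrArg Complex.re (cpow_half_sq (arcDisc b x))
  have h2 := cpow_half_re_nonneg (arcDisc b x)
  generalize arcDisc b x ^ (1 / 2 : ℂ) = d at *
  refine abs_lt_of_sq_lt_sq ?_ h2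
  have h3 : b.re ^ 2 ≤ 1 / 4 := by nlinarith
  simp only [pow_two, Complex.mul_re] at h1
  nlinarith [mul_self_nonneg d.im]

theorem arcSqrt_re_pos : 0 < (arcSqrt b x).re := by
  have h := abs_lt.1 (abs_mul_re_lt hb hb' hx)
  simp only [arcSqrt, Complex.sub_re, Complex.mul_re, Complex.ofReal_re, Complex.ofReal_im]
  linarith

theorem arcPoint_mem_arc : arcPoint b x ∈ arc b := by
  have h := arcSqrt_re_pos hb hb' hx
  refine ⟨?_, x, hx, U_arcPoint h⟩
  rw [V_arcPoint]
  refine pow_ne_zero _ ?_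
  rintro h'
  simp [h'] at h

theorem eq_arcPoint_of_U_eq {z : ℂ} (hV : V b z ≠ 0) (hU : U b z = x) : z = arcPoint b x := by
  have hs := sqrtV_sq b z
  have hs0 : sqrtV b z ≠ 0 := by
    rintro h0
    rw [h0] at hs
    exact hV (by rw [← hs]; norm_num)
  have hre := sqrtV_re_nonneg b z
  unfold U W at hU
  rw [div_eq_iff hs0] at hU
  have hV2 : V b z = b ^ 2 + 1 - 2 * b * z := rfl
  have key : (sqrtV b z - arcSqrt b x) * (sqrtV b z + arcSqrt b x + 2 * b * x) = 0 := by
    linear_combination hs - arcSqrt_quadratic b x + hV2 - 2 * b * hU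
  rcases mul_eq_zero.1 key with h | h
  · rw [sub_eq_zero] at h
    rw [arcPoint, ← h]
    linear_combination hU
  · have h1 := abs_lt.1 (abs_mul_re_lt hb hb' hx)
    have h2 := congrArg Complex.re h
    simp [arcSqrt] at h2 h1
    linarith

end Real

theorem bijOn_U {b : ℂ} (hb : -(1 / 2) ≤ b.re) (hb' : b.re < 0) :
    Set.BijOn (U b) (arc b) ((fun x : ℝ => (x : ℂ)) '' Set.Icc (-1) 1) := by
  refine ⟨?_, ?_, ?_⟩
  · rintro z ⟨-, x, hx, h⟩
    exact ⟨x, hx, h.symm⟩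
  · rintro z ⟨hz, x, hx, h⟩ z' ⟨hz', x', hx', h'⟩ hzz
    rw [h, h', Complex.ofReal_inj] at hzz
    subst hzz
    rw [eq_arcPoint_of_U_eq hb hb' hx hz h, eq_arcPoint_of_U_eq hb hb' hx hz' h']
  · rintro _ ⟨x, hx, rfl⟩
    exact ⟨_, arcPoint_mem_arc hb hb' hx, U_arcPoint (arcSqrt_re_pos hb hb' hx)⟩

theorem Uinv_eq_arcPoint {b : ℂ} (hb : -(1 / 2) ≤ b.re) (hb' : b.re < 0) {x : ℝ}
    (hx : x ∈ Set.Icc (-1 : ℝ) 1) : Uinv b x = arcPoint b x := by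
  have h : ∃ z ∈ arc b, U b z = (x : ℂ) :=
    ⟨_, arcPoint_mem_arc hb hb' hx, U_arcPoint (arcSqrt_re_pos hb hb' hx)⟩
  exact eq_arcPoint_of_U_eq hb hb' hx (Function.invFunOn_mem h).1 (Function.invFunOn_eq h)

/-! ### Comparison of the moduli of `w₁`, `w₂` and `b`. -/

/-- The numbers `w₁, w₂` below have sum `2 W` and product `V` at `z = (ζ + ζ') / 2`. -/
theorem mem_arc_of_norm_eq {b ζ ζ' : ℂ} (hb : -(1 / 2) ≤ b.re) (hb' : b.re < 0)
    (hζ : ζ * ζ' = 1) (h : ‖ζ - b‖ = ‖ζ' - b‖) : (ζ + ζ') / 2 ∈ arc b := by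
  have hV : V b ((ζ + ζ') / 2) = (ζ - b) * (ζ' - b) := by
    unfold V
    linear_combination -hζ
  have h0 : ζ - b ≠ 0 := by
    intro h1
    have h2 : ζ' - b = 0 := by rw [← norm_eq_zero, ← h, h1, norm_zero]
    rw [sub_eq_zero] at h1 h2
    rw [h1, h2] at hζ
    have h3 : (b - 1) * (b + 1) = 0 := by linear_combination hζ
    rcases mul_eq_zero.1 h3 with h3 | h3
    · have := congrArg Complex.re h3
      simp at this
      linarith
    · have := congrArg Complex.re h3
      simp at this
      linarith
  have h0' : ζ' - b ≠ 0 := by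
    rw [← norm_ne_zero_iff, ← h]
    exact norm_ne_zero_iff.2 h0
  have hV0 : V b ((ζ + ζ') / 2) ≠ 0 := by
    rw [hV]
    exact mul_ne_zero h0 h0'
  refine ⟨hV0, ?_⟩
  set r := (ζ - b) / (ζ' - b) with hr
  have hr1 : ‖r‖ = 1 := by
    rw [hr, norm_div, h, div_self (norm_ne_zero_iff.2 h0')]
  -- `U² = (w₁ + w₂)² / (4 w₁ w₂) = (2 + r + 1/r) / 4`, and `1/r` is the conjugate of `r` because
  -- `|r| = 1`.
  have hU : U b ((ζ + ζ') / 2) ^ 2 = (((1 + r.re) / 2 : ℝ) : ℂ) := by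
    have hr2 : r * (starRingEnd ℂ) r = 1 := by
      rw [Complex.mul_conj, Complex.normSq_eq_norm_sq, hr1]
      norm_num
    have hr3 : (starRingEnd ℂ) r = (ζ' - b) / (ζ - b) := by
      rw [eq_div_iff h0]
      have : ζ - b = r * (ζ' - b) := by rw [hr, div_mul_cancel₀ _ h0']
      rw [this]
      linear_combination (ζ' - b) * hr2
    unfold U W
    rw [div_pow, sqrtV_sq, hV]
    push_cast
    rw [Complex.re_eq_add_conj, hr3, hr]
    field_simp
    ring
  have hre := abs_le.1 ((Complex.abs_re_le_norm r).trans hr1.le)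
  have hy : (0 : ℝ) ≤ (1 + r.re) / 2 := by linarith
  have hy1 : √((1 + r.re) / 2) ≤ 1 := Real.sqrt_le_one.2 (by linarith)
  have hy2 := Real.sqrt_nonneg ((1 + r.re) / 2)
  rw [← Real.sq_sqrt hy, Complex.ofReal_pow] at hU
  rcases sq_eq_sq_iff_eq_or_eq_neg.1 hU with h | h
  · exact ⟨_, ⟨by linarith, hy1⟩, h⟩
  · exact ⟨_, ⟨neg_le_neg hy1, by linarith⟩, by rw [h, Complex.ofReal_neg]⟩

/-- The disc `|w - b| ≤ |b|` has `0` on its boundary, so the condition on `ζ' = 1/ζ` is a half-plane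
condition on `ζ`. Adding it to the disc condition on `ζ` gives `|ζ|² + 1 ≤ 4 Re b Re ζ ≤ -2 Re ζ`,
that is, `|ζ + 1|² ≤ 0`. -/
theorem eq_neg_one_of_norm_le {b ζ ζ' : ℂ} (hb : -(1 / 2) ≤ b.re) (hb' : b.re < 0)
    (hζ : ζ * ζ' = 1) (h : ‖ζ - b‖ ≤ ‖b‖) (h' : ‖ζ' - b‖ ≤ ‖b‖) : ζ = -1 := by
  have e : ∀ w : ℂ, ‖w - b‖ ≤ ‖b‖ → w.re ^ 2 + w.im ^ 2 ≤ 2 * (b.re * w.re + b.im * w.im) := by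
    intro w hw
    have := pow_le_pow_left₀ (norm_nonneg _) hw 2
    rw [← Complex.normSq_eq_norm_sq, ← Complex.normSq_eq_norm_sq, Complex.normSq_apply,
      Complex.normSq_apply] at this
    simp at this
    linarith
  have h1 := e _ h
  have h2 := e _ h'
  have r1 := congrArg Complex.re hζ
  have r2 := congrArg Complex.im hζ
  simp at r1 r2
  -- `ζ = |ζ|² conj ζ'`
  have n1 : (ζ'.re ^ 2 + ζ'.im ^ 2) * (ζ.re ^ 2 + ζ.im ^ 2) = 1 := by
    linear_combination (ζ.re * ζ'.re - ζ.im * ζ'.im + 1) * r1 + (ζ.re * ζ'.im + ζ.im * ζ'.re) * r2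
  have n2 : ζ'.re * (ζ.re ^ 2 + ζ.im ^ 2) = ζ.re := by
    linear_combination ζ.re * r1 + ζ.im * r2
  have n3 : ζ'.im * (ζ.re ^ 2 + ζ.im ^ 2) = -ζ.im := by
    linear_combination -ζ.im * r1 + ζ.re * r2
  have h3 : 1 ≤ 2 * (b.re * ζ.re - b.im * ζ.im) := by
    have := mul_le_mul_of_nonneg_right h2 (by positivity : 0 ≤ ζ.re ^ 2 + ζ.im ^ 2)
    rw [n1] at this
    linear_combination this + 2 * b.re * n2 + 2 * b.im * n3
  have h4 : ζ.re < 0 := by nlinarith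
  have h5 : (ζ.re + 1) ^ 2 + ζ.im ^ 2 ≤ 0 := by nlinarith
  apply Complex.ext
  · simp
    nlinarith [sq_nonneg (ζ.re + 1), sq_nonneg ζ.im]
  · simp
    nlinarith [sq_nonneg (ζ.re + 1), sq_nonneg ζ.im]

/-! ### Rigidity of the exterior map. -/

-- The open mapping theorem makes the inverse continuous. It is differentiable wherever `h'` does
-- not vanish at the preimage; the zeros of `h'` are isolated, so the remaining points are removable
-- singularities.
open Metric in
theorem differentiableOn_invFunOn {h : ℂ → ℂ} (hd : DifferentiableOn ℂ h (ball 0 1))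
    (hb : Set.BijOn h (ball 0 1) (ball 0 1)) :
    DifferentiableOn ℂ (Function.invFunOn h (ball 0 1)) (ball 0 1) := by
  set B : Set ℂ := ball 0 1 with hB
  set k := Function.invFunOn h B with hk
  have hBo : IsOpen B := isOpen_ball
  have hkB : ∀ s ∈ B, k s ∈ B := fun s hs => Function.invFunOn_mem (hb.surjOn hs)
  have hhk : ∀ s ∈ B, h (k s) = s := fun s hs => Function.invFunOn_eq (hb.surjOn hs)
  have hkh : ∀ t ∈ B, k (h t) = t := fun t ht =>
    hb.injOn (hkB _ (hb.mapsTo ht)) ht (hhk _ (hb.mapsTo ht))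
  have han : AnalyticOnNhd ℂ h B := hd.analyticOnNhd hBo
  have hnc : ∀ t ∈ B, ¬ ∀ᶠ t' in 𝓝 t, h t' = h t := by
    intro t ht he
    have h1 : ∀ᶠ t' in 𝓝[≠] t, t' = t := by
      filter_upwards [nhdsWithin_le_nhds he, nhdsWithin_le_nhds (hBo.mem_nhds ht)] with t' h1 h2
      exact hb.injOn h2 ht h1
    have h2 : ∀ᶠ t' in 𝓝[≠] t, False := by
      filter_upwards [h1, self_mem_nhdsWithin] with t' h1 h2 using h2 h1
    exact h2.exists.elim fun _ h => h
  have hcont : ∀ s ∈ B, ContinuousAt k s := by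
    intro s hs
    rw [ContinuousAt, tendsto_def]
    intro N hN
    have h1 := ((han _ (hkB s hs)).eventually_constant_or_nhds_le_map_nhds).resolve_left
      (hnc _ (hkB s hs))
    rw [hhk s hs] at h1
    have h2 : h '' (N ∩ B) ∈ 𝓝 s :=
      h1 (image_mem_map (inter_mem hN (hBo.mem_nhds (hkB s hs))))
    refine mem_of_superset h2 ?_
    rintro _ ⟨t, ⟨ht, htB⟩, rfl⟩
    change k (h t) ∈ N
    rwa [hkh t htB]
  have hdiff : ∀ s ∈ B, deriv h (k s) ≠ 0 → DifferentiableAt ℂ k s := by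
    intro s hs h0
    refine (HasDerivAt.of_local_left_inverse (hcont s hs)
      (hd.differentiableAt (hBo.mem_nhds (hkB s hs))).hasDerivAt h0 ?_).differentiableAt
    filter_upwards [hBo.mem_nhds hs] with s' hs' using hhk s' hs'
  intro s hs
  refine DifferentiableAt.differentiableWithinAt ?_
  refine AnalyticAt.differentiableAt
    (Complex.analyticAt_of_differentiable_on_punctured_nhds_of_continuousAt ?_ (hcont s hs))
  have h1 := (han _ (hkB s hs)).deriv.eventually_eq_zero_or_eventually_ne_zero
  rcases h1 with h1 | h1
  · exfalso
    apply hnc _ (hkB s hs)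
    obtain ⟨ε, hε, h2⟩ := Metric.eventually_nhds_iff_ball.1 (h1.and (hBo.mem_nhds (hkB s hs)))
    filter_upwards [ball_mem_nhds _ hε] with t ht
    exact isOpen_ball.is_const_of_deriv_eq_zero (convex_ball _ _).isPreconnected
      (hd.mono fun t ht => (h2 t ht).2) (fun t ht => (h2 t ht).1) ht (mem_ball_self hε)
  · have h2 : Tendsto k (𝓝[≠] s) (𝓝[≠] (k s)) := by
      refine tendsto_nhdsWithin_iff.2 ⟨(hcont s hs).tendsto.mono_left nhdsWithin_le_nhds, ?_⟩
      filter_upwards [nhdsWithin_le_nhds (hBo.mem_nhds hs), self_mem_nhdsWithin] with s' h3 h4 h5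
      apply h4
      have h6 : k s' = k s := h5
      rw [Set.mem_singleton_iff, ← hhk s' h3, h6, hhk s hs]
    filter_upwards [h2.eventually h1, nhdsWithin_le_nhds (hBo.mem_nhds hs)] with s' h3 h4
    exact hdiff s' h4 h3

open Metric in
/-- A holomorphic automorphism of the unit disc that fixes the origin is a rotation. -/
theorem exists_rotation_of_bijOn_ball {h : ℂ → ℂ} (hd : DifferentiableOn ℂ h (ball 0 1))
    (hb : Set.BijOn h (ball 0 1) (ball 0 1)) (h0 : h 0 = 0) :
    ∃ ω : ℂ, ‖ω‖ = 1 ∧ ∀ t ∈ ball (0 : ℂ) 1, h t = ω * t := by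
  set k := Function.invFunOn h (ball 0 1) with hk
  have hkd : DifferentiableOn ℂ k (ball 0 1) := differentiableOn_invFunOn hd hb
  have hkB : ∀ s ∈ ball (0 : ℂ) 1, k s ∈ ball (0 : ℂ) 1 :=
    fun s hs => Function.invFunOn_mem (hb.surjOn hs)
  have hkh : ∀ t ∈ ball (0 : ℂ) 1, k (h t) = t := fun t ht =>
    hb.injOn (hkB _ (hb.mapsTo ht)) ht (Function.invFunOn_eq (hb.surjOn (hb.mapsTo ht)))
  have hk0 : k 0 = 0 := by
    have := hkh 0 (mem_ball_self one_pos)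
    rwa [h0] at this
  -- The Schwarz lemma for `h` and for its inverse. Equality at one nonzero point, here `1/2`, then
  -- forces linearity.
  have e1 : ∀ t ∈ ball (0 : ℂ) 1, ‖h t‖ = ‖t‖ := by
    intro t ht
    apply le_antisymm
    · exact Complex.norm_le_norm_of_mapsTo_ball hd
        (fun x hx => ball_subset_closedBall (hb.mapsTo hx)) h0 (by simpa using ht)
    · have := Complex.norm_le_norm_of_mapsTo_ball hkd
        (fun x hx => ball_subset_closedBall (hkB x hx)) hk0 (z := h t)
        (by simpa using hb.mapsTo ht)
      rwa [hkh t ht] at this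
  have hhalf : (1 / 2 : ℂ) ∈ ball (0 : ℂ) 1 := by
    rw [mem_ball_zero_iff]
    norm_num
  have hs : ‖dslope h 0 (1 / 2)‖ = 1 / 1 := by
    rw [dslope_of_ne _ (by norm_num), slope_def_field, h0, sub_zero, sub_zero, norm_div,
      e1 _ hhalf]
    norm_num
  have haff := Complex.affine_of_mapsTo_ball_of_norm_dslope_eq_div hd
    (by rw [h0]; exact fun x hx => ball_subset_closedBall (hb.mapsTo hx)) hhalf hs
  refine ⟨dslope h 0 (1 / 2), by rw [hs]; norm_num, fun t ht => ?_⟩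
  rw [haff ht, h0]
  simp [mul_comm]

open Metric in
/-- A holomorphic automorphism of `{|w| > 1}` that fixes infinity is a rotation. -/
theorem exists_rotation_of_bijOn_exterior {g : ℂ → ℂ}
    (hd : DifferentiableOn ℂ g {w : ℂ | 1 < ‖w‖})
    (hb : Set.BijOn g {w : ℂ | 1 < ‖w‖} {w : ℂ | 1 < ‖w‖})
    (hinf : Tendsto g (Bornology.cobounded ℂ) (Bornology.cobounded ℂ)) :
    ∃ ω : ℂ, ‖ω‖ = 1 ∧ ∀ w : ℂ, 1 < ‖w‖ → g w = ω * w := by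
  classical
  -- Inversion carries the exterior to the punctured disc; the behaviour at infinity makes `0` a
  -- removable singularity with value `0`.
  set h : ℂ → ℂ := fun t => if t = 0 then 0 else (g t⁻¹)⁻¹ with hh
  have h0 : h 0 = 0 := if_pos rfl
  have hne : ∀ t, t ≠ 0 → h t = (g t⁻¹)⁻¹ := fun t ht => if_neg ht
  have inv_mem : ∀ t : ℂ, t ∈ ball (0 : ℂ) 1 → t ≠ 0 → t⁻¹ ∈ {w : ℂ | 1 < ‖w‖} := by
    intro t ht ht0
    rw [mem_ball_zero_iff] at ht
    rw [Set.mem_ofPred_eq, norm_inv]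
    exact (one_lt_inv₀ (norm_pos_iff.2 ht0)).2 ht
  have mem_inv : ∀ w : ℂ, w ∈ {w : ℂ | 1 < ‖w‖} → w⁻¹ ∈ ball (0 : ℂ) 1 ∧ w⁻¹ ≠ 0 := by
    intro w hw
    rw [Set.mem_ofPred_eq] at hw
    refine ⟨?_, inv_ne_zero (norm_pos_iff.1 (by linarith))⟩
    rw [mem_ball_zero_iff, norm_inv]
    exact inv_lt_one_of_one_lt₀ hw
  have hbij : Set.BijOn h (ball 0 1) (ball 0 1) := by
    have hn0 : ∀ t ∈ ball (0 : ℂ) 1, t ≠ 0 → h t ∈ ball (0 : ℂ) 1 ∧ h t ≠ 0 := by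
      intro t ht ht0
      rw [hne t ht0]
      exact mem_inv _ (hb.mapsTo (inv_mem t ht ht0))
    refine ⟨?_, ?_, ?_⟩
    · intro t ht
      by_cases ht0 : t = 0
      · rw [ht0, h0]
        exact mem_ball_self one_pos
      · exact (hn0 t ht ht0).1
    · intro t ht t' ht' e
      by_cases ht0 : t = 0
      · by_contra hcon
        subst ht0
        rw [h0] at e
        exact (hn0 t' ht' (Ne.symm hcon)).2 e.symm
      · by_cases ht0' : t' = 0
        · rw [ht0', h0] at e
          exact absurd e (hn0 t ht ht0).2
        · rw [hne t ht0, hne t' ht0'] at e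
          exact inv_injective (hb.injOn (inv_mem t ht ht0) (inv_mem t' ht' ht0')
            (inv_injective e))
    · intro s hs
      by_cases hs0 : s = 0
      · exact ⟨0, mem_ball_self one_pos, by rw [h0, hs0]⟩
      · obtain ⟨w, hw, e⟩ := hb.surjOn (inv_mem s hs hs0)
        refine ⟨w⁻¹, (mem_inv w hw).1, ?_⟩
        rw [hne _ (mem_inv w hw).2, inv_inv, e, inv_inv]
  have hcont : ContinuousAt h 0 := by
    rw [continuousAt_iff_punctured_nhds, h0]
    have h1 : Tendsto (fun t : ℂ => (g t⁻¹)⁻¹) (𝓝[≠] 0) (𝓝 0) :=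
      tendsto_inv₀_cobounded.comp (hinf.comp tendsto_inv₀_nhdsNE_zero)
    refine h1.congr' ?_
    filter_upwards [self_mem_nhdsWithin] with t ht using (hne t ht).symm
  have hopen : IsOpen {w : ℂ | 1 < ‖w‖} := isOpen_lt continuous_const continuous_norm
  have hdiff : DifferentiableOn ℂ h (ball 0 1) := by
    rw [← Complex.differentiableOn_compl_singleton_and_continuousAt_iff
      (ball_mem_nhds (0 : ℂ) one_pos)]
    refine ⟨?_, hcont⟩
    rintro t ⟨ht, ht0⟩
    have ht0 : t ≠ 0 := ht0
    refine DifferentiableAt.differentiableWithinAt ?_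
    have hm := inv_mem t ht ht0
    have h1 : DifferentiableAt ℂ (fun t : ℂ => (g t⁻¹)⁻¹) t := by
      refine DifferentiableAt.fun_inv ?_ ?_
      · exact (hd.differentiableAt (hopen.mem_nhds hm)).comp t (differentiableAt_inv ht0)
      · have : 1 < ‖g t⁻¹‖ := hb.mapsTo hm
        exact norm_pos_iff.1 (by linarith)
    refine h1.congr_of_eventuallyEq ?_
    filter_upwards [isOpen_ne.mem_nhds ht0] with s hs using hne s hs
  obtain ⟨ω, hω, e⟩ := exists_rotation_of_bijOn_ball hdiff hbij h0
  refine ⟨ω⁻¹, by rw [norm_inv, hω, inv_one], fun w hw => ?_⟩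
  have h2 := e _ (mem_inv w hw).1
  rw [hne _ (mem_inv w hw).2, inv_inv] at h2
  rw [← inv_inv (g w), h2, mul_inv, inv_inv]

/-! ### Closed form of the Faber polynomials. -/

/-- The polynomials in `z` that give the power sums `w₁ ^ n + w₂ ^ n` of the two roots of
`w ^ 2 - 2 W(z) w + V(z)`. -/
def rootPowerSum (b : ℂ) : ℕ → ℂ[X]
  | 0 => 2
  | 1 => 2 * (X - C b)
  | n + 2 => 2 * (X - C b) * rootPowerSum b (n + 1) -
      (C (b ^ 2 + 1) - C (2 * b) * X) * rootPowerSum b n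

theorem eval_rootPowerSum {b z w₁ w₂ : ℂ} (hs : w₁ + w₂ = 2 * (z - b)) (hp : w₁ * w₂ = V b z) :
    ∀ n, (rootPowerSum b n).eval z = w₁ ^ n + w₂ ^ n
  | 0 => by simp [rootPowerSum]; norm_num
  | 1 => by simp [rootPowerSum, hs]
  | n + 2 => by
    have h1 := eval_rootPowerSum hs hp (n + 1)
    have h2 := eval_rootPowerSum hs hp n
    rw [rootPowerSum]
    simp only [eval_sub, eval_mul, eval_ofNat, eval_X, eval_C]
    rw [h1, h2, ← hs, show b ^ 2 + 1 - 2 * b * z = w₁ * w₂ from hp.symm]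
    ring

theorem natDegree_rootPowerSum_le (b : ℂ) : ∀ n, (rootPowerSum b n).natDegree ≤ n
  | 0 => by simp [rootPowerSum]
  | 1 => by
    rw [rootPowerSum]
    compute_degree
  | n + 2 => by
    have h1 := natDegree_rootPowerSum_le b (n + 1)
    have h2 := natDegree_rootPowerSum_le b n
    rw [rootPowerSum]
    refine (natDegree_sub_le _ _).trans (max_le ?_ ?_)
    · refine natDegree_mul_le.trans ?_
      have : (2 * (X - C b)).natDegree ≤ 1 := by compute_degree
      omega
    · refine natDegree_mul_le.trans ?_
      have : (C (b ^ 2 + 1) - C (2 * b) * X).natDegree ≤ 1 := by compute_degree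
      omega

theorem norm_coeffB_lt_norm_coeffA {R θ : ℝ} (hb' : (coeffB R θ).re < 0) :
    ‖coeffB R θ‖ < ‖coeffA R θ‖ := by
  have ha : coeffA R θ = 1 - coeffB R θ := by rw [coeffB]; ring
  rw [ha]
  generalize coeffB R θ = b at *
  refine lt_of_pow_lt_pow_left₀ 2 (norm_nonneg _) ?_
  rw [← Complex.normSq_eq_norm_sq, ← Complex.normSq_eq_norm_sq, Complex.normSq_apply,
    Complex.normSq_apply]
  simp
  nlinarith

theorem affine_ne_zero {R θ : ℝ} (hb' : (coeffB R θ).re < 0) {w : ℂ} (hw : 1 < ‖w‖) :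
    coeffA R θ * w + coeffB R θ ≠ 0 := by
  intro h
  have h1 := norm_coeffB_lt_norm_coeffA hb'
  rw [eq_neg_of_add_eq_zero_right h, norm_neg, norm_mul] at h1
  nlinarith [norm_nonneg (coeffA R θ)]

/-- The circle about `b` through `1` and its image under inversion touch at `1`, and their
exteriors are otherwise separated. -/
theorem not_norm_lt_and_norm_lt {b ζ ζ' : ℂ} (hb' : b.re < 0) (hζ : ζ * ζ' = 1)
    (h : ‖1 - b‖ < ‖ζ - b‖) (h' : ‖1 - b‖ < ‖ζ' - b‖) : False := by
  have e : ∀ w : ℂ, ‖1 - b‖ < ‖w - b‖ →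
      1 - 2 * b.re < w.re ^ 2 + w.im ^ 2 - 2 * (b.re * w.re + b.im * w.im) := by
    intro w hw
    have := pow_lt_pow_left₀ hw (norm_nonneg _) two_ne_zero
    rw [← Complex.normSq_eq_norm_sq, ← Complex.normSq_eq_norm_sq, Complex.normSq_apply,
      Complex.normSq_apply] at this
    simp at this
    linarith
  have h1 := e _ h
  have h2 := e _ h'
  have r1 := congrArg Complex.re hζ
  have r2 := congrArg Complex.im hζ
  simp at r1 r2
  have n1 : (ζ'.re ^ 2 + ζ'.im ^ 2) * (ζ.re ^ 2 + ζ.im ^ 2) = 1 := by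
    linear_combination (ζ.re * ζ'.re - ζ.im * ζ'.im + 1) * r1 + (ζ.re * ζ'.im + ζ.im * ζ'.re) * r2
  have n2 : ζ'.re * (ζ.re ^ 2 + ζ.im ^ 2) = ζ.re := by
    linear_combination ζ.re * r1 + ζ.im * r2
  have n3 : ζ'.im * (ζ.re ^ 2 + ζ.im ^ 2) = -ζ.im := by
    linear_combination -ζ.im * r1 + ζ.re * r2
  have n0 : 0 < ζ.re ^ 2 + ζ.im ^ 2 := by
    refine lt_of_le_of_ne (by positivity) fun h0 => ?_
    rw [← h0] at n1
    simp at n1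
  have h3 : (1 - 2 * b.re) * (ζ.re ^ 2 + ζ.im ^ 2) < 1 - 2 * (b.re * ζ.re - b.im * ζ.im) := by
    have := mul_lt_mul_of_pos_right h2 n0
    linear_combination this + n1 - 2 * b.re * n2 - 2 * b.im * n3
  -- The sum of `h1` and `h3` reads `-2 Re b |ζ - 1|² < 0`.
  nlinarith [mul_nonneg (neg_nonneg.2 hb'.le) (add_nonneg (sq_nonneg (ζ.re - 1)) (sq_nonneg ζ.im))]

/-- The Joukowski map identifies distinct points only when their product is `1`, and two such points
cannot both lie outside the circle about `b` through `1`. -/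
theorem injOn_psi {R θ : ℝ} (hb' : (coeffB R θ).re < 0) :
    Set.InjOn (psi R θ) {w : ℂ | 1 < ‖w‖} := by
  intro w hw w' hw' e
  rw [Set.mem_ofPred_eq] at hw hw'
  have h0 := affine_ne_zero hb' hw
  have h0' := affine_ne_zero hb' hw'
  have ha : coeffA R θ = 1 - coeffB R θ := by rw [coeffB]; ring
  have hapos := (norm_nonneg _).trans_lt (norm_coeffB_lt_norm_coeffA hb')
  have hn : ∀ v : ℂ, 1 < ‖v‖ →
      ‖1 - coeffB R θ‖ < ‖coeffA R θ * v + coeffB R θ - coeffB R θ‖ := by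
    intro v hv
    rw [add_sub_cancel_right, norm_mul, ← ha]
    nlinarith
  have h1 := hn w hw
  have h1' := hn w' hw'
  unfold psi joukowskiMap at e
  have ha0 : coeffA R θ ≠ 0 := norm_pos_iff.1 hapos
  have key : coeffA R θ * (w - w') *
      ((coeffA R θ * w + coeffB R θ) * (coeffA R θ * w' + coeffB R θ) - 1) = 0 := by
    field_simp at e
    linear_combination e
  rcases mul_eq_zero.1 key with h | h
  · exact sub_eq_zero.1 ((mul_eq_zero.1 h).resolve_left ha0)
  · exact (not_norm_lt_and_norm_lt hb' (sub_eq_zero.1 h) h1 h1').elim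

theorem tendsto_affine {R θ : ℝ} (hb' : (coeffB R θ).re < 0) :
    Tendsto (fun w => coeffA R θ * w + coeffB R θ) (Bornology.cobounded ℂ)
      (Bornology.cobounded ℂ) := by
  have hapos := (norm_nonneg _).trans_lt (norm_coeffB_lt_norm_coeffA hb')
  rw [← tendsto_norm_atTop_iff_cobounded]
  refine tendsto_atTop_mono (f := fun w : ℂ => ‖coeffA R θ‖ * ‖w‖ - ‖coeffB R θ‖) (fun w => ?_) ?_
  · rw [← norm_mul, ← norm_neg (coeffB R θ), ← sub_neg_eq_add (coeffA R θ * w)]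
    exact norm_sub_norm_le _ _
  · exact tendsto_atTop_add_const_right _ _
      (tendsto_norm_cobounded_atTop.const_mul_atTop hapos)

theorem tendsto_psi {R θ : ℝ} (hb' : (coeffB R θ).re < 0) :
    Tendsto (psi R θ) (Bornology.cobounded ℂ) (Bornology.cobounded ℂ) := by
  have h1 := tendsto_affine hb'
  rw [← tendsto_norm_atTop_iff_cobounded]
  have h2 : Tendsto (fun ζ : ℂ => ‖joukowskiMap ζ‖) (Bornology.cobounded ℂ) atTop := by
    have h3 : Tendsto (fun ζ : ℂ => (‖ζ‖ - 1) / 2) (Bornology.cobounded ℂ) atTop :=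
      (tendsto_atTop_add_const_right _ (-1) tendsto_norm_cobounded_atTop).atTop_div_const two_pos
    refine tendsto_atTop_mono' _ ?_ h3
    filter_upwards [tendsto_norm_cobounded_atTop.eventually_ge_atTop (1 : ℝ)] with ζ hζ
    rw [joukowskiMap, norm_div, Complex.norm_ofNat]
    have h4 : ‖1 / ζ‖ ≤ 1 := by
      rw [norm_div, norm_one]
      exact div_le_one_of_le₀ hζ (norm_nonneg _)
    have h5 := norm_sub_norm_le ζ (-(1 / ζ))
    rw [norm_neg, sub_neg_eq_add] at h5
    linarith
  exact h2.comp h1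

theorem differentiableOn_psi {R θ : ℝ} (hb' : (coeffB R θ).re < 0) :
    DifferentiableOn ℂ (psi R θ) {w : ℂ | 1 < ‖w‖} := by
  intro w hw
  have h0 := affine_ne_zero hb' hw
  unfold psi joukowskiMap
  refine DifferentiableAt.differentiableWithinAt ?_
  have h1 : DifferentiableAt ℂ (fun w => coeffA R θ * w + coeffB R θ) w := by fun_prop
  exact (h1.add ((differentiableAt_const _).div h1 h0)).div_const 2

theorem IsExteriorMap.exists_rotation {R θ : ℝ} (hb' : (coeffB R θ).re < 0) {Φ : ℂ → ℂ}
    (hΦ : IsExteriorMap (airfoil R θ) Φ) :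
    ∃ ω : ℂ, ‖ω‖ = 1 ∧ ∀ w : ℂ, 1 < ‖w‖ → Φ (psi R θ w) = ω * w := by
  have hK : (airfoil R θ)ᶜ = psi R θ '' {w : ℂ | 1 < ‖w‖} := compl_compl _
  have h1 := hΦ.differentiableOn
  have h2 := hΦ.bijOn
  rw [hK] at h1 h2
  have hψ : Set.BijOn (psi R θ) {w : ℂ | 1 < ‖w‖} (psi R θ '' {w : ℂ | 1 < ‖w‖}) :=
    (injOn_psi hb').bijOn_image
  exact exists_rotation_of_bijOn_exterior
    (h1.comp (differentiableOn_psi hb') hψ.mapsTo) (h2.comp hψ)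
    (hΦ.tendsto_infty.comp (tendsto_psi hb'))

theorem eq_zero_of_tendsto_eval {l : Filter ℂ} [l.NeBot] {g : ℂ → ℂ}
    (hg : Tendsto g l (Bornology.cobounded ℂ)) {Q : ℂ[X]}
    (hQ : Tendsto (fun w => Q.eval (g w)) l (𝓝 0)) : Q = 0 := by
  by_cases hd : 0 < Q.degree
  · have h1 := Q.tendsto_norm_atTop hd (tendsto_norm_atTop_iff_cobounded.2 hg)
    exact absurd hQ.norm (not_tendsto_nhds_of_tendsto_atTop h1 _)
  · rw [eq_C_of_degree_le_zero (not_lt.1 hd)] at hQ ⊢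
    simp only [eval_C] at hQ
    rw [tendsto_nhds_unique tendsto_const_nhds hQ, C_0]

/-- Along `z = Ψ(w)` both sides differ from `(ω w) ^ n` by a quantity tending to `0`, and a
polynomial that tends to `0` at infinity is zero. -/
theorem IsFaberPolynomial.eq {R θ : ℝ} (hb' : (coeffB R θ).re < 0) {Φ : ℂ → ℂ} {ω : ℂ}
    (hΦ : ∀ w : ℂ, 1 < ‖w‖ → Φ (psi R θ w) = ω * w) {n : ℕ} {F : ℂ[X]}
    (hF : IsFaberPolynomial Φ n F) :
    F = C ((ω / coeffA R θ) ^ n) *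
      (rootPowerSum (coeffB R θ) n - C ((-coeffB R θ) ^ n)) := by
  have ha0 : coeffA R θ ≠ 0 :=
    norm_pos_iff.1 ((norm_nonneg _).trans_lt (norm_coeffB_lt_norm_coeffA hb'))
  refine sub_eq_zero.1 (eq_zero_of_tendsto_eval (tendsto_psi hb') ?_)
  have h1 : Tendsto (fun w => F.eval (psi R θ w) - Φ (psi R θ w) ^ n)
      (Bornology.cobounded ℂ) (𝓝 0) :=
    (hF.trans_tendsto tendsto_inv₀_cobounded).comp (tendsto_psi hb')
  have h2 : Tendsto (fun w => (ω / coeffA R θ) ^ n *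
      (((coeffA R θ * w + coeffB R θ)⁻¹ - coeffB R θ) ^ n - (-coeffB R θ) ^ n))
      (Bornology.cobounded ℂ) (𝓝 0) := by
    have h3 := (((tendsto_inv₀_cobounded.comp (tendsto_affine hb')).sub_const
      (coeffB R θ)).pow n).sub_const ((-coeffB R θ) ^ n) |>.const_mul ((ω / coeffA R θ) ^ n)
    simpa using h3
  have h4 := h1.sub h2
  rw [sub_zero] at h4
  refine h4.congr' ?_
  filter_upwards [tendsto_norm_cobounded_atTop.eventually_gt_atTop (1 : ℝ)] with w hw
  have h0 := affine_ne_zero hb' hw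
  rw [hΦ w hw]
  have hs : coeffA R θ * w + ((coeffA R θ * w + coeffB R θ)⁻¹ - coeffB R θ) =
      2 * (psi R θ w - coeffB R θ) := by
    rw [psi, joukowskiMap]
    field_simp
    ring
  have hp : coeffA R θ * w * ((coeffA R θ * w + coeffB R θ)⁻¹ - coeffB R θ) =
      V (coeffB R θ) (psi R θ w) := by
    rw [V, psi, joukowskiMap]
    field_simp
    ring
  rw [eval_sub, eval_mul, eval_sub, eval_C, eval_C, eval_rootPowerSum hs hp]
  rw [mul_pow, mul_pow, div_pow]
  field_simp
  ring

/-! ### All zeros approach the arc. -/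

theorem exists_joukowski_eq (z : ℂ) : ∃ ζ : ℂ, 1 ≤ ‖ζ‖ ∧ (ζ + ζ⁻¹) / 2 = z := by
  set d := (z ^ 2 - 1) ^ (1 / 2 : ℂ)
  have hd : d ^ 2 = z ^ 2 - 1 := cpow_half_sq _
  have hp : (z + d) * (z - d) = 1 := by linear_combination -hd
  have h1 : (z + d)⁻¹ = z - d := (eq_inv_of_mul_eq_one_right hp).symm
  have h2 : (z - d)⁻¹ = z + d := by rw [← h1, inv_inv]
  rcases le_total 1 ‖z + d‖ with h | h
  · exact ⟨z + d, h, by rw [h1]; ring⟩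
  · refine ⟨z - d, ?_, by rw [h2]; ring⟩
    rw [← h1, norm_inv]
    refine (one_le_inv₀ (norm_pos_iff.2 ?_)).2 h
    exact left_ne_zero_of_mul_eq_one hp

/-- Off a neighbourhood of the arc, one of the three numbers `w₁, w₂, b` dominates the other two. -/
theorem exists_dominance_ratio {b : ℂ} (hb : -(1 / 2) ≤ b.re) (hb' : b.re < 0) {ε : ℝ}
    (hε : 0 < ε) : ∃ q : ℝ, 0 < q ∧ q < 1 ∧ ∀ ζ : ℂ, 1 ≤ ‖ζ‖ →
      (ζ + ζ⁻¹) / 2 ∉ Metric.thickening ε (arc b) →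
      0 < max ‖ζ - b‖ ‖ζ⁻¹ - b‖ ∧
      max (min ‖ζ - b‖ ‖ζ⁻¹ - b‖) ‖b‖ ≤ q * max ‖ζ - b‖ ‖ζ⁻¹ - b‖ := by
  -- For `|ζ| > L` the largest modulus exceeds `2 + 2 |b|` while the others are at most `1 + |b|`,
  -- so the ratio `1/2` serves. The annulus `1 ≤ |ζ| ≤ L` is left to compactness.
  set L : ℝ := 2 + 3 * ‖b‖ with hL
  set S : Set ℂ := {ζ | (1 ≤ ‖ζ‖ ∧ ‖ζ‖ ≤ L) ∧ (ζ + ζ⁻¹) / 2 ∉ Metric.thickening ε (arc b)} with hS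
  set M : ℂ → ℝ := fun ζ => max ‖ζ - b‖ ‖ζ⁻¹ - b‖ with hM
  set m : ℂ → ℝ := fun ζ => max (min ‖ζ - b‖ ‖ζ⁻¹ - b‖) ‖b‖ with hm
  have hA : ContinuousOn (fun ζ : ℂ => ζ⁻¹) {ζ | 1 ≤ ‖ζ‖ ∧ ‖ζ‖ ≤ L} :=
    continuousOn_inv₀.mono fun ζ hζ => norm_pos_iff.1 (by linarith [hζ.1])
  have hAcl : IsClosed {ζ : ℂ | 1 ≤ ‖ζ‖ ∧ ‖ζ‖ ≤ L} :=
    (isClosed_le continuous_const continuous_norm).inter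
      (isClosed_le continuous_norm continuous_const)
  have hScl : IsClosed S := by
    have h1 : ContinuousOn (fun ζ : ℂ => (ζ + ζ⁻¹) / 2) {ζ | 1 ≤ ‖ζ‖ ∧ ‖ζ‖ ≤ L} :=
      (continuousOn_id.add hA).div_const 2
    exact h1.preimage_isClosed_of_isClosed hAcl Metric.isOpen_thickening.isClosed_compl
  have hSc : IsCompact S := by
    refine (isCompact_closedBall (0 : ℂ) L).of_isClosed_subset hScl fun ζ hζ => ?_
    rw [mem_closedBall_zero_iff]
    exact hζ.1.2
  have hlt : ∀ ζ ∈ S, 0 < M ζ ∧ m ζ < M ζ := by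
    intro ζ hζ
    have h0 : ζ ≠ 0 := norm_pos_iff.1 (by linarith [hζ.1.1])
    have hp : ζ * ζ⁻¹ = 1 := mul_inv_cancel₀ h0
    have hne : ‖ζ - b‖ ≠ ‖ζ⁻¹ - b‖ := fun h =>
      hζ.2 (Metric.self_subset_thickening hε _ (mem_arc_of_norm_eq hb hb' hp h))
    have hmm : min ‖ζ - b‖ ‖ζ⁻¹ - b‖ < M ζ := min_lt_max.2 hne
    have hbM : ‖b‖ < M ζ := by
      by_contra! hcon
      have h1 := eq_neg_one_of_norm_le hb hb' hp ((le_max_left _ _).trans hcon)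
        ((le_max_right _ _).trans hcon)
      apply hne
      rw [h1]
      norm_num
    exact ⟨(norm_nonneg _).trans_lt hbM, max_lt hmm hbM⟩
  have hAS : ContinuousOn (fun ζ : ℂ => ζ⁻¹) S := hA.mono fun ζ hζ => hζ.1
  have hMc : ContinuousOn M S := by
    have h1 : ContinuousOn (fun ζ : ℂ => ‖ζ - b‖) S := by fun_prop
    exact h1.sup (hAS.sub continuousOn_const).norm
  have hmc : ContinuousOn m S := by
    have h1 : ContinuousOn (fun ζ : ℂ => ‖ζ - b‖) S := by fun_prop
    exact (h1.inf (hAS.sub continuousOn_const).norm).sup continuousOn_const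
  obtain ⟨q, hq1, hq⟩ : ∃ q : ℝ, q < 1 ∧ ∀ ζ ∈ S, m ζ ≤ q * M ζ := by
    rcases S.eq_empty_or_nonempty with he | hne
    · exact ⟨0, one_pos, by simp [he]⟩
    · obtain ⟨ζ₀, hζ₀, hmax⟩ := hSc.exists_isMaxOn hne
        (hmc.div hMc fun ζ hζ => (hlt ζ hζ).1.ne')
      refine ⟨m ζ₀ / M ζ₀, (div_lt_one (hlt _ hζ₀).1).2 (hlt _ hζ₀).2, fun ζ hζ => ?_⟩
      rw [← div_le_iff₀ (hlt ζ hζ).1]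
      exact hmax hζ
  refine ⟨max q (1 / 2), by positivity, max_lt hq1 (by norm_num), fun ζ h1 hζ => ?_⟩
  by_cases hζL : ‖ζ‖ ≤ L
  · have hmem : ζ ∈ S := ⟨⟨h1, hζL⟩, hζ⟩
    exact ⟨(hlt ζ hmem).1, (hq ζ hmem).trans
      (mul_le_mul_of_nonneg_right (le_max_left _ _) (hlt ζ hmem).1.le)⟩
  · have h2 : ‖ζ‖ - ‖b‖ ≤ M ζ := (norm_sub_norm_le _ _).trans (le_max_left _ _)
    have h3 : ‖ζ⁻¹ - b‖ ≤ 1 + ‖b‖ := by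
      refine (norm_sub_le _ _).trans (add_le_add_left ?_ _)
      rw [norm_inv]
      exact inv_le_one_of_one_le₀ h1
    have hb0 := norm_nonneg b
    have h4 : m ζ ≤ 1 + ‖b‖ := max_le ((min_le_right _ _).trans h3) (by linarith)
    have h5 : 0 < M ζ := by linarith
    refine ⟨h5, h4.trans ?_⟩
    have := mul_le_mul_of_nonneg_right (le_max_right q (1 / 2)) h5.le
    linarith

theorem eventually_root_mem_thickening {b : ℂ} (hb : -(1 / 2) ≤ b.re) (hb' : b.re < 0) {ε : ℝ}
    (hε : 0 < ε) : ∀ᶠ n in atTop, ∀ z : ℂ, (rootPowerSum b n).eval z = (-b) ^ n →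
      z ∈ Metric.thickening ε (arc b) := by
  obtain ⟨q, hq0, hq1, hq⟩ := exists_dominance_ratio hb hb' hε
  filter_upwards [(tendsto_pow_atTop_nhds_zero_of_lt_one hq0.le hq1).eventually
    (gt_mem_nhds (show (0 : ℝ) < 1 / 2 by norm_num))] with n hn z hz
  by_contra hcon
  obtain ⟨ζ, h1, rfl⟩ := exists_joukowski_eq z
  obtain ⟨hM, hmM⟩ := hq ζ h1 hcon
  have h0 : ζ ≠ 0 := norm_pos_iff.1 (by linarith)
  rw [eval_rootPowerSum (w₁ := ζ - b) (w₂ := ζ⁻¹ - b) (by ring)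
    (by unfold V; field_simp; ring)] at hz
  -- If `u` dominates, `|u| ^ n ≤ |b| ^ n + |v| ^ n ≤ 2 q ^ n |u| ^ n < |u| ^ n`.
  have key : ∀ u v : ℂ, u ^ n + v ^ n = (-b) ^ n → ‖v‖ ≤ ‖u‖ →
      max (min ‖u‖ ‖v‖) ‖b‖ ≤ q * max ‖u‖ ‖v‖ → 0 < max ‖u‖ ‖v‖ → False := by
    intro u v h huv hm hpos
    rw [max_eq_left huv] at hm hpos
    rw [min_eq_right huv, max_le_iff] at hm
    have e1 : u ^ n = (-b) ^ n - v ^ n := by rw [← h]; ring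
    have e2 : ‖u‖ ^ n ≤ ‖b‖ ^ n + ‖v‖ ^ n := by
      rw [← norm_pow, e1]
      refine (norm_sub_le _ _).trans ?_
      rw [norm_pow, norm_pow, norm_neg]
    have e3 := pow_le_pow_left₀ (norm_nonneg _) hm.1 n
    have e4 := pow_le_pow_left₀ (norm_nonneg _) hm.2 n
    rw [mul_pow] at e3 e4
    have e5 := pow_pos hpos n
    nlinarith
  rcases le_total ‖ζ⁻¹ - b‖ ‖ζ - b‖ with h | h
  · exact key _ _ hz h hmM hM
  · refine key _ _ (by rw [add_comm]; exact hz) h ?_ ?_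
    · rwa [min_comm, max_comm ‖ζ⁻¹ - b‖]
    · rwa [max_comm]

/-! ### Zeros near the Chebyshev nodes. -/

/-- The points `b + s e^{±iφ}` have product `1`. If `|s| ≤ |b|`, both equal `-1` by
`eq_neg_one_of_norm_le`, hence `s sin φ = 0`. -/
theorem norm_lt_norm_arcSqrt {b : ℂ} (hb : -(1 / 2) ≤ b.re) (hb' : b.re < 0) {φ : ℝ}
    (hφ : Real.sin φ ≠ 0) : ‖b‖ < ‖arcSqrt b (Real.cos φ)‖ := by
  by_contra! hcon
  have hre := arcSqrt_re_pos hb hb' (x := Real.cos φ) ⟨Real.neg_one_le_cos φ, Real.cos_le_one φ⟩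
  have hq := arcSqrt_quadratic b (Real.cos φ)
  set s := arcSqrt b (Real.cos φ) with hs
  have hs0 : s ≠ 0 := by
    rintro h
    simp [h] at hre
  have hcs : (Real.cos φ : ℂ) ^ 2 + (Real.sin φ : ℂ) ^ 2 = 1 := by
    exact_mod_cast Real.cos_sq_add_sin_sq φ
  set c : ℂ := (Real.cos φ : ℂ) with hc
  set σ : ℂ := (Real.sin φ : ℂ) with hσ
  have hI := Complex.I_sq
  have hp : (b + s * (c + σ * Complex.I)) * (b + s * (c - σ * Complex.I)) = 1 := by
    linear_combination hq + s ^ 2 * hcs - s ^ 2 * σ ^ 2 * hI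
  have n1 : ‖c + σ * Complex.I‖ = 1 := by
    rw [hc, hσ, Complex.ofReal_cos, Complex.ofReal_sin, ← Complex.exp_mul_I,
      Complex.norm_exp_ofReal_mul_I]
  have n2 : ‖c - σ * Complex.I‖ = 1 := by
    rw [← n1, ← Complex.norm_conj (c + σ * Complex.I)]
    simp [hc, hσ, sub_eq_add_neg, -Complex.ofReal_cos, -Complex.ofReal_sin]
  have h1 := eq_neg_one_of_norm_le hb hb' hp
    (by rw [add_sub_cancel_left, norm_mul, n1, mul_one]; exact hcon)
    (by rw [add_sub_cancel_left, norm_mul, n2, mul_one]; exact hcon)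
  have h2 := eq_neg_one_of_norm_le hb hb' (mul_comm (b + s * (c + σ * Complex.I)) _ ▸ hp)
    (by rw [add_sub_cancel_left, norm_mul, n2, mul_one]; exact hcon)
    (by rw [add_sub_cancel_left, norm_mul, n1, mul_one]; exact hcon)
  have h3 : 2 * s * Complex.I * σ = 0 := by linear_combination h1 - h2
  have h4 : σ ≠ 0 := Complex.ofReal_ne_zero.2 hφ
  simp [hs0, h4] at h3

theorem eval_rootPowerSum_arcPoint_cos (b φ : ℂ) (n : ℕ) :
    (rootPowerSum b n).eval (arcPoint b (Complex.cos φ)) =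
      arcSqrt b (Complex.cos φ) ^ n * (2 * Complex.cos (n * φ)) := by
  have h := Complex.two_cos φ
  have hprod : Complex.exp (φ * Complex.I) * Complex.exp (-φ * Complex.I) = 1 := by
    rw [← Complex.exp_add]
    simp
  rw [eval_rootPowerSum
    (w₁ := arcSqrt b (Complex.cos φ) * Complex.exp (φ * Complex.I))
    (w₂ := arcSqrt b (Complex.cos φ) * Complex.exp (-φ * Complex.I)), Complex.two_cos,
    mul_pow, mul_pow, ← Complex.exp_nat_mul, ← Complex.exp_nat_mul, mul_add]
  · congr 3
    · ring_nf
    · ring_nf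
  · rw [arcPoint]
    linear_combination -arcSqrt b (Complex.cos φ) * h
  · rw [V_arcPoint]
    linear_combination arcSqrt b (Complex.cos φ) ^ 2 * hprod

theorem analyticAt_arcSqrt_cos {b φ : ℂ} (h : arcDisc b (Complex.cos φ) ∈ Complex.slitPlane) :
    AnalyticAt ℂ (fun φ => arcSqrt b (Complex.cos φ)) φ := by
  have hcos : AnalyticAt ℂ Complex.cos φ := Complex.analyticAt_cos
  have h1 : AnalyticAt ℂ (fun φ => arcDisc b (Complex.cos φ)) φ := by
    unfold arcDisc
    fun_prop
  unfold arcSqrt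
  exact (h1.cpow analyticAt_const h).sub (analyticAt_const.mul hcos)

/-- The points `φ` at which `arcPoint b (cos φ)` can be compared with the zeros. -/
def goodSet (b : ℂ) (q : ℝ) : Set ℂ :=
  {φ | arcDisc b (Complex.cos φ) ∈ Complex.slitPlane ∧ 0 < (arcSqrt b (Complex.cos φ)).re ∧
    ‖b‖ < q * ‖arcSqrt b (Complex.cos φ)‖ ∧ 0 < φ.re ∧ φ.re < Real.pi}

theorem isOpen_goodSet (b : ℂ) (q : ℝ) : IsOpen (goodSet b q) := by
  rw [isOpen_iff_mem_nhds]
  rintro φ ⟨h1, h2, h3, h4, h5⟩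
  have hs := (analyticAt_arcSqrt_cos h1).continuousAt
  have hd : Continuous fun φ => arcDisc b (Complex.cos φ) := by
    unfold arcDisc
    fun_prop
  filter_upwards [hd.continuousAt.eventually (Complex.isOpen_slitPlane.mem_nhds h1),
    (Complex.continuous_re.continuousAt.comp hs).eventually (lt_mem_nhds h2),
    (hs.norm.const_mul q).eventually (lt_mem_nhds h3),
    Complex.continuous_re.continuousAt.eventually (lt_mem_nhds h4),
    Complex.continuous_re.continuousAt.eventually (gt_mem_nhds h5)] with ψ k1 k2 k3 k4 k5
  exact ⟨k1, k2, k3, k4, k5⟩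

theorem exists_image_Icc_subset_goodSet {b : ℂ} (hb : -(1 / 2) ≤ b.re) (hb' : b.re < 0) {δ : ℝ}
    (hδ : 0 < δ) : ∃ q : ℝ, 0 < q ∧ q < 1 ∧
      (fun x : ℝ => (x : ℂ)) '' Set.Icc δ (Real.pi - δ) ⊆ goodSet b q := by
  have hcos : ∀ φ : ℝ, Real.cos φ ∈ Set.Icc (-1 : ℝ) 1 := fun φ =>
    ⟨Real.neg_one_le_cos φ, Real.cos_le_one φ⟩
  have hc : Continuous fun φ : ℝ => arcSqrt b (Real.cos φ) := by
    rw [continuous_iff_continuousAt]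
    intro φ
    have h1 := (analyticAt_arcSqrt_cos (b := b) (φ := φ) (by
      rw [← Complex.ofReal_cos]
      exact arcDisc_mem_slitPlane hb hb' (hcos φ))).continuousAt
    have h2 : ContinuousAt (fun φ : ℝ => arcSqrt b (Complex.cos φ)) φ :=
      ContinuousAt.comp (f := fun x : ℝ => (x : ℂ)) h1 Complex.continuous_ofReal.continuousAt
    simpa using h2
  have hne : ∀ φ : ℝ, arcSqrt b (Real.cos φ) ≠ 0 := fun φ h => by
    have := arcSqrt_re_pos hb hb' (hcos φ)
    rw [h] at this
    simp at this
  have hcr : Continuous fun φ : ℝ => ‖b‖ / ‖arcSqrt b (Real.cos φ)‖ :=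
    continuous_const.div hc.norm fun φ => norm_ne_zero_iff.2 (hne φ)
  have hlt : ∀ φ ∈ Set.Icc δ (Real.pi - δ), ‖b‖ / ‖arcSqrt b (Real.cos φ)‖ < 1 := by
    intro φ hφ
    rw [div_lt_one (norm_pos_iff.2 (hne φ))]
    exact norm_lt_norm_arcSqrt hb hb'
      (Real.sin_pos_of_pos_of_lt_pi (by linarith [hφ.1]) (by linarith [hφ.2])).ne'
  obtain ⟨q, hq0, hq1, hq⟩ : ∃ q : ℝ, 0 < q ∧ q < 1 ∧
      ∀ φ ∈ Set.Icc δ (Real.pi - δ), ‖b‖ / ‖arcSqrt b (Real.cos φ)‖ < q := by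
    rcases (Set.Icc δ (Real.pi - δ)).eq_empty_or_nonempty with he | hn
    · exact ⟨1 / 2, by norm_num, by norm_num, by simp [he]⟩
    · obtain ⟨φ₀, hφ₀, hmax⟩ := isCompact_Icc.exists_isMaxOn hn hcr.continuousOn
      obtain ⟨q, h1, h2⟩ := exists_between (hlt φ₀ hφ₀)
      exact ⟨q, lt_of_le_of_lt (by positivity) h1, h2, fun φ hφ => (hmax hφ).trans_lt h1⟩
  refine ⟨q, hq0, hq1, ?_⟩
  rintro _ ⟨φ, hφ, rfl⟩
  refine ⟨?_, ?_, ?_, ?_, ?_⟩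
  · rw [← Complex.ofReal_cos]
    exact arcDisc_mem_slitPlane hb hb' (hcos φ)
  · rw [← Complex.ofReal_cos]
    exact arcSqrt_re_pos hb hb' (hcos φ)
  · rw [← Complex.ofReal_cos, ← div_lt_iff₀ (norm_pos_iff.2 (hne φ))]
    exact hq φ hφ
  · simp only [Complex.ofReal_re]
    linarith [hφ.1]
  · simp only [Complex.ofReal_re]
    linarith [hφ.2]

/-- No zero `kπ` of the sine has modulus `1`. This bounds `cos (n φ)` below, uniformly in `n`, on
the circle of radius `1/n` about a node. -/
theorem exists_norm_sin_ge : ∃ m : ℝ, 0 < m ∧ ∀ w : ℂ, ‖w‖ = 1 → m ≤ ‖Complex.sin w‖ := by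
  obtain ⟨w₀, hw₀, hmin⟩ := (isCompact_sphere (0 : ℂ) 1).exists_isMinOn
    (NormedSpace.sphere_nonempty.2 zero_le_one) Complex.continuous_sin.norm.continuousOn
  refine ⟨‖Complex.sin w₀‖, norm_pos_iff.2 fun h => ?_, fun w hw => hmin (by simpa using hw)⟩
  obtain ⟨k, rfl⟩ := Complex.sin_eq_zero_iff.1 h
  rw [mem_sphere_zero_iff_norm, norm_mul, Complex.norm_intCast, Complex.norm_real,
    Real.norm_of_nonneg Real.pi_pos.le] at hw₀
  by_cases hk : k = 0
  · simp [hk] at hw₀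
  · have h1 : (1 : ℝ) ≤ |(k : ℝ)| := by
      rw [← Int.cast_abs]
      exact_mod_cast Int.one_le_abs hk
    nlinarith [Real.pi_gt_three]

/-- The arguments of the zeros of the Chebyshev polynomial `T_n`. -/
def chebyshevAngle (n j : ℕ) : ℝ := (2 * j + 1) * Real.pi / (2 * n)

theorem cos_nat_mul_chebyshevAngle_add {n : ℕ} (hn : n ≠ 0) (j : ℕ) (w : ℂ) :
    Complex.cos (n * (chebyshevAngle n j + w)) = -((-1) ^ j * Complex.sin (n * w)) := by
  have h : (n : ℂ) * (chebyshevAngle n j + w) = (n * w + Real.pi / 2) + j * Real.pi := by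
    unfold chebyshevAngle
    push_cast
    have : (n : ℂ) ≠ 0 := Nat.cast_ne_zero.2 hn
    field_simp
    ring
  rw [h, Complex.cos_antiperiodic.add_nat_mul_eq, Complex.cos_add_pi_div_two]
  ring

-- A Rouché-type argument: at the node `f` is only the perturbation, of size at most `q ^ n < m /
-- 2`. On the circle of radius `1/n` it differs from that value by at least `2 m - 2 q ^ n ≥ m`. The
-- quantitative open mapping theorem puts the ball of radius `m / 2` about `f φ₀` inside the image,
-- and this ball contains `0`.
open Metric in
theorem exists_zero_near_chebyshevAngle {b : ℂ} {q m : ℝ} (hm : 0 < m)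
    (hsin : ∀ w : ℂ, ‖w‖ = 1 → m ≤ ‖Complex.sin w‖) {n : ℕ} (hn : n ≠ 0) {j : ℕ}
    (hqm : q ^ n < m / 2) (hball : closedBall (chebyshevAngle n j : ℂ) (1 / n) ⊆ goodSet b q) :
    ∃ φ ∈ closedBall (chebyshevAngle n j : ℂ) (1 / n),
      (rootPowerSum b n).eval (arcPoint b (Complex.cos φ)) = (-b) ^ n := by
  have hn0 : (0 : ℝ) < n := Nat.cast_pos.2 (Nat.pos_of_ne_zero hn)
  have hr : (0 : ℝ) < 1 / n := by positivity
  set φ₀ : ℂ := (chebyshevAngle n j : ℂ) with hφ₀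
  have hs0 : ∀ φ ∈ goodSet b q, arcSqrt b (Complex.cos φ) ≠ 0 := by
    intro φ hφ h
    have := hφ.2.1
    simp [h] at this
  set E : ℂ → ℂ := fun φ => (-b / arcSqrt b (Complex.cos φ)) ^ n with hE
  set f : ℂ → ℂ := fun φ => 2 * Complex.cos (n * φ) - E φ with hf
  have hEle : ∀ φ ∈ goodSet b q, ‖E φ‖ ≤ q ^ n := by
    intro φ hφ
    rw [hE, norm_pow]
    refine pow_le_pow_left₀ (norm_nonneg _) ?_ n
    rw [norm_div, norm_neg, div_le_iff₀ (norm_pos_iff.2 (hs0 φ hφ))]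
    exact hφ.2.2.1.le
  have hfan : AnalyticOnNhd ℂ f (closedBall φ₀ (1 / n)) := by
    intro φ hφ
    have hg := hball hφ
    have h1 : AnalyticAt ℂ (fun φ : ℂ => Complex.cos (n * φ)) φ := by fun_prop
    exact (analyticAt_const.mul h1).sub
      ((analyticAt_const.div (analyticAt_arcSqrt_cos hg.1) (hs0 φ hg)).pow n)
  have hf0 : f φ₀ = -E φ₀ := by
    have := cos_nat_mul_chebyshevAngle_add hn j 0
    rw [add_zero, mul_zero, Complex.sin_zero, mul_zero, neg_zero] at this
    rw [hf]
    simp only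
    rw [this]
    ring
  have hc : φ₀ ∈ closedBall φ₀ (1 / n) := mem_closedBall_self hr.le
  have hsph : ∀ φ ∈ sphere φ₀ (1 / n), m ≤ ‖f φ - f φ₀‖ := by
    intro φ hφ
    have h1 := hEle φ (hball (sphere_subset_closedBall hφ))
    have h2 := hEle φ₀ (hball hc)
    have h3 : m ≤ ‖Complex.cos (n * φ)‖ := by
      have e := cos_nat_mul_chebyshevAngle_add hn j (φ - φ₀)
      rw [← hφ₀, add_sub_cancel] at e
      rw [e, norm_neg, norm_mul, norm_pow, norm_neg, norm_one, one_pow, one_mul]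
      apply hsin
      rw [mem_sphere_iff_norm] at hφ
      rw [norm_mul, hφ, Complex.norm_natCast]
      field_simp
    have h4 : f φ - f φ₀ = 2 * Complex.cos (n * φ) - (E φ - E φ₀) := by
      rw [hf0, hf]
      ring
    have h5 := norm_sub_norm_le (2 * Complex.cos (n * φ)) (E φ - E φ₀)
    have h6 := norm_sub_le (E φ) (E φ₀)
    rw [norm_mul, Complex.norm_ofNat] at h5
    rw [h4]
    linarith
  have hfreq : ∃ᶠ φ in 𝓝 φ₀, f φ ≠ f φ₀ := by
    intro hcon
    have h1 : f =ᶠ[𝓝 φ₀] fun _ => f φ₀ := by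
      filter_upwards [hcon] with φ hφ using not_not.1 hφ
    have h2 := hfan.eqOn_of_preconnected_of_eventuallyEq analyticOnNhd_const
      (convex_closedBall _ _).isPreconnected hc h1
    obtain ⟨φ, hφ⟩ := (NormedSpace.sphere_nonempty (x := φ₀)).2 hr.le
    have h3 := hsph φ hφ
    rw [h2 (sphere_subset_closedBall hφ), sub_self, norm_zero] at h3
    linarith
  have hsub := (hfan.differentiableOn.diffContOnCl_ball subset_rfl).ball_subset_image_closedBall
    hr hsph hfreq
  have h0 : (0 : ℂ) ∈ ball (f φ₀) (m / 2) := by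
    rw [mem_ball', dist_zero_right, hf0, norm_neg]
    exact (hEle φ₀ (hball hc)).trans_lt hqm
  obtain ⟨φ, hφ, h⟩ := hsub h0
  refine ⟨φ, hφ, ?_⟩
  rw [eval_rootPowerSum_arcPoint_cos, sub_eq_zero.1 h, hE]
  simp only
  rw [div_pow, mul_div_cancel₀ _ (pow_ne_zero n (hs0 φ (hball hφ)))]

/-- `U` recovers `cos φ`, and the cosine is injective on the strip `0 < Re φ < π`. Distinct
parameters therefore give distinct zeros. -/
theorem injOn_arcPoint_cos (b : ℂ) (q : ℝ) :
    Set.InjOn (fun φ => arcPoint b (Complex.cos φ)) (goodSet b q) := by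
  intro φ hφ φ' hφ' h
  have h1 : Complex.cos φ = Complex.cos φ' := by
    rw [← U_arcPoint hφ.2.1, ← U_arcPoint hφ'.2.1]
    exact congrArg _ h
  obtain ⟨k, hk⟩ := Complex.cos_eq_cos_iff.1 h1
  obtain ⟨-, -, -, p1, p2⟩ := hφ
  obtain ⟨-, -, -, p1', p2'⟩ := hφ'
  have hpi := Real.pi_pos
  have e : ∀ k : ℤ, (2 * k * Real.pi : ℂ).re = 2 * k * Real.pi := by
    intro k
    have : (2 * k * Real.pi : ℂ) = ((2 * k * Real.pi : ℝ) : ℂ) := by push_cast; rfl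
    rw [this, Complex.ofReal_re]
  rcases hk with hk | hk
  · have h2 := congrArg Complex.re hk
    rw [Complex.add_re, e] at h2
    have h3 : (k : ℝ) < 1 := by nlinarith
    have h4 : (-1 : ℝ) < k := by nlinarith
    have h5 : k < 1 := by exact_mod_cast h3
    have h6 : -1 < k := by exact_mod_cast h4
    have h7 : k = 0 := by omega
    rw [hk, h7]
    simp
  · have h2 := congrArg Complex.re hk
    rw [Complex.sub_re, e] at h2
    have h3 : (k : ℝ) < 1 := by nlinarith
    have h4 : (0 : ℝ) < k := by nlinarith
    have h5 : k < 1 := by exact_mod_cast h3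
    have h6 : 0 < k := by exact_mod_cast h4
    omega

/-! ### Averages over the zeros as Riemann sums. -/

/-- Two sums of a bounded function are close if most terms of one can be matched with
most terms of the other. -/
theorem abs_multiset_sum_sub_sum_le {α : Type*} [DecidableEq α] {f : α → ℝ} {C e : ℝ}
    (hC : ∀ x, |f x| ≤ C) (he : 0 ≤ e) {s : Multiset α} {n : ℕ} (hs : s.card ≤ n) {J : Finset ℕ}
    (hJ : J ⊆ Finset.range n) {r x : ℕ → α} (hr : Set.InjOn r J) (hrs : ∀ j ∈ J, r j ∈ s)
    (hfe : ∀ j ∈ J, |f (r j) - f (x j)| ≤ e) :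
    |(s.map f).sum - ∑ j ∈ Finset.range n, f (x j)| ≤ n * e + 2 * C * (n - J.card) := by
  have hle : (J.image r).val ≤ s := by
    rw [Multiset.le_iff_subset (J.image r).nodup]
    intro y hy
    obtain ⟨j, hj, rfl⟩ := Finset.mem_image.1 hy
    exact hrs j hj
  obtain ⟨t, rfl⟩ := Multiset.le_iff_exists_add.1 hle
  have hJn : J.card ≤ n := by simpa using Finset.card_le_card hJ
  -- `t` collects the unmatched elements of `s`. They and the unmatched indices each contribute at
  -- most `C (n - J.card)`.
  have ht : (t.card : ℝ) ≤ n - J.card := by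
    rw [Multiset.card_add, Finset.card_val, Finset.card_image_of_injOn hr] at hs
    rw [le_sub_iff_add_le, add_comm]
    exact_mod_cast hs
  have hts : |(t.map f).sum| ≤ C * t.card := by
    clear hs hle hrs ht
    induction t using Multiset.induction_on with
    | empty => simp
    | cons y t ih =>
      rw [Multiset.map_cons, Multiset.sum_cons, Multiset.card_cons]
      push_cast
      refine (abs_add_le _ _).trans ?_
      linarith [hC y]
  have hZ : ((J.image r).val.map f).sum = ∑ j ∈ J, f (r j) := Finset.sum_image hr
  have hd : |∑ j ∈ J, f (r j) - ∑ j ∈ J, f (x j)| ≤ n * e := by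
    rw [← Finset.sum_sub_distrib]
    refine (Finset.abs_sum_le_sum_abs _ _).trans ((Finset.sum_le_sum hfe).trans ?_)
    rw [Finset.sum_const, nsmul_eq_mul]
    exact mul_le_mul_of_nonneg_right (Nat.cast_le.2 hJn) he
  have hrest : |∑ j ∈ Finset.range n \ J, f (x j)| ≤ C * (n - J.card) := by
    refine (Finset.abs_sum_le_sum_abs _ _).trans
      ((Finset.sum_le_sum fun j _ => hC (x j)).trans ?_)
    rw [Finset.sum_const, nsmul_eq_mul, Finset.card_sdiff_of_subset hJ, Finset.card_range,
      Nat.cast_sub hJn, mul_comm]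
  have hsplit := Finset.sum_sdiff hJ (f := fun j => f (x j))
  have hC0 : 0 ≤ C := (abs_nonneg _).trans (hC (r 0))
  rw [Multiset.map_add, Multiset.sum_add, hZ, ← hsplit]
  have := mul_le_mul_of_nonneg_left ht hC0
  rw [abs_le] at *
  constructor <;> linarith [hts.1, hts.2, hd.1, hd.2, hrest.1, hrest.2]

/-- Riemann sums at midpoints. -/
theorem tendsto_sum_chebyshevAngle {h : ℝ → ℝ} (hh : Continuous h) :
    Tendsto (fun n : ℕ => (n : ℝ)⁻¹ * ∑ j ∈ Finset.range n, h (chebyshevAngle n j)) atTop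
      (𝓝 (Real.pi⁻¹ * ∫ θ in 0..Real.pi, h θ)) := by
  have hpi := Real.pi_pos
  have huc := isCompact_Icc (a := (0 : ℝ)) (b := Real.pi) |>.uniformContinuousOn_of_continuous
    hh.continuousOn
  rw [Metric.tendsto_atTop]
  intro ε hε
  obtain ⟨δ, hδ, hd⟩ := Metric.uniformContinuousOn_iff.1 huc (ε / 2) (by positivity)
  obtain ⟨N, hN⟩ := exists_nat_gt (Real.pi / δ)
  refine ⟨N + 1, fun n hn => ?_⟩
  have hn0 : (0 : ℝ) < n := Nat.cast_pos.2 (by omega)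
  have hnδ : Real.pi / n < δ := by
    rw [div_lt_comm₀ hn0 hδ] at *
    refine hN.trans ?_
    exact_mod_cast hn
  set a : ℕ → ℝ := fun j => j * (Real.pi / n) with ha
  have hint : ∑ j ∈ Finset.range n, ∫ θ in a j..a (j + 1), h θ = ∫ θ in 0..Real.pi, h θ := by
    rw [intervalIntegral.sum_integral_adjacent_intervals fun k _ => hh.intervalIntegrable _ _]
    congr 1
    · simp [ha]
    · simp only [ha]
      field_simp
  have hstep : ∀ j, a (j + 1) - a j = Real.pi / n := by
    intro j
    simp only [ha]
    push_cast
    ring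
  have hpn : 0 < Real.pi / n := by positivity
  have hterm : ∀ j ∈ Finset.range n,
      ‖(Real.pi / n) * h (chebyshevAngle n j) - ∫ θ in a j..a (j + 1), h θ‖ ≤
        ε / 2 * (Real.pi / n) := by
    intro j hj
    have hj1 : (j : ℝ) + 1 ≤ n := by exact_mod_cast Finset.mem_range.1 hj
    have h0 : 0 ≤ a j := by positivity
    have hmid : chebyshevAngle n j = a j + Real.pi / n / 2 := by
      simp only [chebyshevAngle, ha]
      field_simp
    have h1 : a (j + 1) ≤ Real.pi := by
      simp only [ha]
      push_cast
      calc ((j : ℝ) + 1) * (Real.pi / n) ≤ n * (Real.pi / n) :=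
            mul_le_mul_of_nonneg_right hj1 hpn.le
        _ = Real.pi := by field_simp
    have e1 : (Real.pi / n) * h (chebyshevAngle n j) =
        ∫ θ in a j..a (j + 1), h (chebyshevAngle n j) := by
      rw [intervalIntegral.integral_const, hstep, smul_eq_mul]
    rw [e1, ← intervalIntegral.integral_sub (intervalIntegrable_const)
      (hh.intervalIntegrable _ _)]
    have hs := hstep j
    have := intervalIntegral.norm_integral_le_of_norm_le_const (a := a j) (b := a (j + 1))
      (f := fun θ => h (chebyshevAngle n j) - h θ) (C := ε / 2) (fun θ hθ => ?_)
    · rwa [hs, abs_of_pos hpn] at this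
    · rw [Set.uIoc_of_le (by linarith)] at hθ
      rw [← dist_eq_norm]
      refine (hd _ ⟨by linarith, by linarith⟩ _ ⟨by linarith [hθ.1], by linarith [hθ.2]⟩ ?_).le
      rw [Real.dist_eq, abs_lt]
      constructor <;> linarith [hθ.1, hθ.2]
  have hsum := (norm_sum_le _ _).trans (Finset.sum_le_sum hterm)
  rw [Finset.sum_sub_distrib, hint, ← Finset.mul_sum, Finset.sum_const, Finset.card_range,
    nsmul_eq_mul] at hsum
  have e2 : (n : ℝ)⁻¹ * ∑ j ∈ Finset.range n, h (chebyshevAngle n j) -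
      Real.pi⁻¹ * ∫ θ in 0..Real.pi, h θ = Real.pi⁻¹ *
        ((Real.pi / n) * ∑ j ∈ Finset.range n, h (chebyshevAngle n j) -
          ∫ θ in 0..Real.pi, h θ) := by
    field_simp
  rw [dist_eq_norm, e2, norm_mul, norm_inv, Real.norm_of_nonneg hpi.le]
  calc _ ≤ Real.pi⁻¹ * (n * (ε / 2 * (Real.pi / n))) := by gcongr
    _ = ε / 2 := by field_simp
    _ < ε := by linarith

theorem chebyshevAngle_mem_Icc {L n j : ℕ} (hL : 0 < L) (hn : 0 < n)
    (hj : j ∈ Finset.Ico (n / L) (n - n / L)) :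
    chebyshevAngle n j ∈ Set.Icc (Real.pi / (2 * L)) (Real.pi - Real.pi / (2 * L)) := by
  rw [Finset.mem_Ico] at hj
  have hL0 : (0 : ℝ) < L := Nat.cast_pos.2 hL
  have hn0 : (0 : ℝ) < n := Nat.cast_pos.2 hn
  have hpi := Real.pi_pos
  have h1 : (n : ℝ) / L < (n / L : ℕ) + 1 := by
    rw [div_lt_iff₀ hL0]
    exact_mod_cast (Nat.div_lt_iff_lt_mul hL).1 (Nat.lt_succ_self (n / L))
  have h2 : ((n / L : ℕ) : ℝ) ≤ j := by exact_mod_cast hj.1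
  have h3 : (j : ℝ) + 1 + (n / L : ℕ) ≤ n := by
    have : j + 1 + n / L ≤ n := by omega
    exact_mod_cast this
  have hj0 : (0 : ℝ) ≤ j := Nat.cast_nonneg j
  have hk0 : (0 : ℝ) ≤ (n / L : ℕ) := Nat.cast_nonneg _
  have e1 : Real.pi / (2 * L) = (n / L : ℝ) * (Real.pi / (2 * n)) := by field_simp
  have e2 : chebyshevAngle n j = (2 * j + 1) * (Real.pi / (2 * n)) := mul_div_assoc _ _ _
  have e3 : Real.pi = 2 * n * (Real.pi / (2 * n)) := by field_simp
  have hu : 0 < Real.pi / (2 * n) := by positivity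
  constructor
  · rw [e1, e2]
    exact mul_le_mul_of_nonneg_right (by linarith) hu.le
  · rw [e1, e2]
    nth_rewrite 2 [e3]
    rw [← sub_mul]
    exact mul_le_mul_of_nonneg_right (by linarith) hu.le

open Metric in
/-- The averages of `f` over the zeros and over the images of the Chebyshev nodes agree up to
the contribution of a small proportion of the zeros. -/
theorem eventually_abs_sum_roots_sub_le {b : ℂ} (hb : -(1 / 2) ≤ b.re) (hb' : b.re < 0)
    {f : ℂ → ℝ} (hf : Continuous f) {C : ℝ} (hC : ∀ z, |f z| ≤ C) {L : ℕ} (hL : 0 < L) {e : ℝ}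
    (he : 0 < e) :
    ∀ᶠ n : ℕ in atTop, ∀ s : Multiset ℂ, s.card ≤ n →
      (∀ z, (rootPowerSum b n).eval z = (-b) ^ n → z ∈ s) →
      |(s.map f).sum - ∑ j ∈ Finset.range n, f (arcPoint b (Real.cos (chebyshevAngle n j)))| ≤
        n * e + 4 * C * (n / L) := by
  classical
  have hL0 : (0 : ℝ) < L := Nat.cast_pos.2 hL
  have hpi := Real.pi_pos
  obtain ⟨q, hq0, hq1, hK⟩ := exists_image_Icc_subset_goodSet hb hb'
    (show 0 < Real.pi / (2 * L) by positivity)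
  set K : Set ℂ := (fun x : ℝ => (x : ℂ)) ''
    Set.Icc (Real.pi / (2 * L)) (Real.pi - Real.pi / (2 * L)) with hKdef
  have hKc : IsCompact K := isCompact_Icc.image Complex.continuous_ofReal
  obtain ⟨η, hη, hηK⟩ := hKc.exists_cthickening_subset_open (isOpen_goodSet b q) hK
  have hNc : IsCompact (cthickening η K) := hKc.cthickening
  have hcont : ContinuousOn (fun φ => f (arcPoint b (Complex.cos φ))) (cthickening η K) := by
    refine hf.comp_continuousOn fun φ hφ => ?_
    have h1 := (analyticAt_arcSqrt_cos (hηK hφ).1).continuousAt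
    unfold arcPoint
    exact (continuousAt_const.add
      (Complex.continuous_cos.continuousAt.mul h1)).continuousWithinAt
  obtain ⟨δ, hδ, hd⟩ := Metric.uniformContinuousOn_iff.1
    (hNc.uniformContinuousOn_of_continuous hcont) e he
  obtain ⟨m, hm, hsin⟩ := exists_norm_sin_ge
  have ht : Tendsto (fun n : ℕ => 1 / (n : ℝ)) atTop (𝓝 0) := tendsto_one_div_atTop_nhds_zero_nat
  filter_upwards [eventually_gt_atTop 0, ht.eventually (gt_mem_nhds hδ),
    ht.eventually (gt_mem_nhds hη), (tendsto_pow_atTop_nhds_zero_of_lt_one hq0.le hq1).eventually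
      (gt_mem_nhds (half_pos hm))] with n hn hnδ hnη hqm s hs hroots
  have hn0 : (0 : ℝ) < n := Nat.cast_pos.2 hn
  -- About `n / L` nodes are dropped at each end, where `|b / s|` may approach `1`.
  set J := Finset.Ico (n / L) (n - n / L) with hJ
  have hmemK : ∀ j ∈ J, (chebyshevAngle n j : ℂ) ∈ K := fun j hj =>
    ⟨_, chebyshevAngle_mem_Icc hL hn hj, rfl⟩
  have hball : ∀ j ∈ J, closedBall (chebyshevAngle n j : ℂ) (1 / n) ⊆ cthickening η K :=
    fun j hj => (closedBall_subset_closedBall hnη.le).trans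
      (closedBall_subset_cthickening (hmemK j hj) η)
  have hex : ∀ j, ∃ φ : ℂ, j ∈ J → φ ∈ closedBall (chebyshevAngle n j : ℂ) (1 / n) ∧
      (rootPowerSum b n).eval (arcPoint b (Complex.cos φ)) = (-b) ^ n := by
    intro j
    by_cases hj : j ∈ J
    · obtain ⟨φ, h1, h2⟩ := exists_zero_near_chebyshevAngle hm hsin hn.ne' hqm
        ((hball j hj).trans hηK)
      exact ⟨φ, fun _ => ⟨h1, h2⟩⟩
    · exact ⟨0, fun h => absurd h hj⟩
  choose ψ hψ using hex
  have hinj : Set.InjOn (fun j => arcPoint b (Complex.cos (ψ j))) J := by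
    intro j hj i hi hji
    have h1 : ψ j = ψ i := injOn_arcPoint_cos b q (hηK (hball j hj (hψ j hj).1))
      (hηK (hball i hi (hψ i hi).1)) hji
    -- Distinct nodes are at least `π / n > 2 / n` apart, so their discs are disjoint.
    have h2 : dist (chebyshevAngle n j : ℂ) (chebyshevAngle n i) ≤ 1 / n + 1 / n := by
      refine (dist_triangle _ (ψ j) _).trans (add_le_add ?_ ?_)
      · exact mem_closedBall'.1 (hψ j hj).1
      · rw [h1]
        exact mem_closedBall.1 (hψ i hi).1
    rw [dist_eq_norm, ← Complex.ofReal_sub, Complex.norm_real, Real.norm_eq_abs] at h2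
    have h3 : chebyshevAngle n j - chebyshevAngle n i = ((j : ℤ) - (i : ℤ) : ℤ) * (Real.pi / n) := by
      unfold chebyshevAngle
      push_cast
      field_simp
      ring
    by_contra hne
    have h4 : (1 : ℝ) ≤ |(((j : ℤ) - (i : ℤ) : ℤ) : ℝ)| := by
      rw [← Int.cast_abs]
      exact_mod_cast Int.one_le_abs (by omega : (j : ℤ) - (i : ℤ) ≠ 0)
    rw [h3, abs_mul, abs_of_pos (by positivity : 0 < Real.pi / n)] at h2
    have h5 := mul_le_mul_of_nonneg_right h4 (by positivity : 0 ≤ Real.pi / n)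
    have h6 : Real.pi / n ≤ 2 / n := by
      have h7 : (1 : ℝ) / n + 1 / n = 2 / n := by ring
      linarith
    rw [div_le_div_iff_of_pos_right hn0] at h6
    linarith [Real.pi_gt_three]
  have hk : ((n / L : ℕ) : ℝ) ≤ n / L := Nat.cast_div_le
  have hcard : (n : ℝ) - J.card ≤ 2 * (n / L) := by
    have h1 : n ≤ J.card + 2 * (n / L) := by
      rw [hJ, Nat.card_Ico]
      omega
    have h2 : (n : ℝ) ≤ J.card + 2 * (n / L : ℕ) := by exact_mod_cast h1
    linarith
  have hmain := abs_multiset_sum_sub_sum_le hC he.le hs (J := J) (n := n)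
    (fun j hj => Finset.mem_range.2 ((Finset.mem_Ico.1 hj).2.trans_le (Nat.sub_le _ _))) hinj
    (x := fun j => arcPoint b (Real.cos (chebyshevAngle n j)))
    (fun j hj => hroots _ (hψ j hj).2) (fun j hj => ?_)
  · refine hmain.trans ?_
    have hC0 : 0 ≤ C := (abs_nonneg _).trans (hC 0)
    have := mul_le_mul_of_nonneg_left hcard hC0
    linarith
  · have h1 := hd (ψ j) (hball j hj (hψ j hj).1) (chebyshevAngle n j)
      (self_subset_cthickening _ (hmemK j hj))
      ((mem_closedBall.1 (hψ j hj).1).trans_lt hnδ)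
    rw [Real.dist_eq, ← Complex.ofReal_cos] at h1
    exact h1.le

theorem IsFaberPolynomial.ne_zero {K : Set ℂ} {Φ : ℂ → ℂ} (hΦ : IsExteriorMap K Φ) {n : ℕ}
    {F : ℂ[X]} (hF : IsFaberPolynomial Φ n F) : F ≠ 0 := by
  rintro rfl
  have h1 := (hF.trans_tendsto tendsto_inv₀_cobounded).norm
  obtain ⟨z, h2, h3⟩ := ((h1.eventually (gt_mem_nhds (show ‖(0 : ℂ)‖ < 1 by simp))).and
    ((tendsto_norm_cobounded_atTop.comp hΦ.tendsto_infty).eventually_ge_atTop (1 : ℝ))).exists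
  rw [eval_zero, zero_sub, norm_neg, norm_pow] at h2
  exact absurd (one_le_pow₀ h3) (not_le.2 h2)

theorem continuous_arcPoint_cos {b : ℂ} (hb : -(1 / 2) ≤ b.re) (hb' : b.re < 0) :
    Continuous fun θ : ℝ => arcPoint b (Real.cos θ) := by
  rw [continuous_iff_continuousAt]
  intro θ
  have h1 : AnalyticAt ℂ (fun φ => arcSqrt b (Complex.cos φ)) θ := analyticAt_arcSqrt_cos (by
    rw [← Complex.ofReal_cos]
    exact arcDisc_mem_slitPlane hb hb' ⟨Real.neg_one_le_cos θ, Real.cos_le_one θ⟩)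
  have h2 : ContinuousAt (fun φ => arcPoint b (Complex.cos φ)) θ := by
    unfold arcPoint
    exact continuousAt_const.add (Complex.continuous_cos.continuousAt.mul h1.continuousAt)
  have h3 : ContinuousAt (fun θ : ℝ => arcPoint b (Complex.cos θ)) θ :=
    ContinuousAt.comp (f := fun x : ℝ => (x : ℂ)) h2 Complex.continuous_ofReal.continuousAt
  simpa using h3

theorem tendsto_average_roots {b : ℂ} (hb : -(1 / 2) ≤ b.re) (hb' : b.re < 0)
    {f : ℂ → ℝ} (hf : Continuous f) {C : ℝ} (hC : ∀ z, |f z| ≤ C) {s : ℕ → Multiset ℂ}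
    (hs : ∀ n, (s n).card ≤ n)
    (hroots : ∀ᶠ n in atTop, ∀ z, (rootPowerSum b n).eval z = (-b) ^ n → z ∈ s n) :
    Tendsto (fun n : ℕ => (n : ℝ)⁻¹ * ((s n).map f).sum) atTop
      (𝓝 (Real.pi⁻¹ * ∫ θ in 0..Real.pi, f (arcPoint b (Real.cos θ)))) := by
  have h1 := tendsto_sum_chebyshevAngle (hf.comp (continuous_arcPoint_cos hb hb'))
  refine h1.congr_dist ?_
  rw [Metric.tendsto_atTop']
  intro ε hε
  have hC0 : 0 ≤ C := (abs_nonneg _).trans (hC 0)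
  obtain ⟨L, hL⟩ := exists_nat_gt (4 * C / (ε / 2))
  have hL0 : (0 : ℝ) < L := lt_of_le_of_lt (by positivity) hL
  have hL1 : 4 * C / L < ε / 2 := by
    rw [div_lt_iff₀ (by positivity)] at hL
    rw [div_lt_iff₀ hL0]
    linarith
  obtain ⟨N, hN⟩ := eventually_atTop.1 ((eventually_abs_sum_roots_sub_le hb hb' hf hC
    (Nat.cast_pos.1 hL0) (half_pos (half_pos hε))).and (hroots.and (eventually_gt_atTop 0)))
  refine ⟨N, fun n hn => ?_⟩
  obtain ⟨h2, h3, h4⟩ := hN n hn.le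
  have hn0 : (0 : ℝ) < n := Nat.cast_pos.2 h4
  have h5 := h2 (s n) (hs n) h3
  rw [dist_zero_right, Real.norm_of_nonneg dist_nonneg, dist_comm, Real.dist_eq, ← mul_sub,
    abs_mul, abs_of_pos (inv_pos.2 hn0)]
  calc _ ≤ (n : ℝ)⁻¹ * (n * (ε / 2 / 2) + 4 * C * (n / L)) :=
        mul_le_mul_of_nonneg_left h5 (inv_pos.2 hn0).le
    _ = ε / 2 / 2 + 4 * C / L := by field_simp
    _ < ε := by linarith

/-! ### Integrals against the two measures. -/

theorem integral_multiset_sum_diracProba (f : ℂ → ℝ) (s : Multiset ℂ) :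
    Integrable f ((s.map fun z => (diracProba z).toFiniteMeasure).sum : FiniteMeasure ℂ) ∧
    ∫ z, f z ∂((s.map fun z => (diracProba z).toFiniteMeasure).sum : FiniteMeasure ℂ) =
      (s.map f).sum := by
  induction s using Multiset.induction_on with
  | empty => simp
  | cons y s ih =>
    have hy : ((diracProba y).toFiniteMeasure : Measure ℂ) = Measure.dirac y := rfl
    have hi : Integrable f ((diracProba y).toFiniteMeasure : Measure ℂ) := by
      rw [hy]
      exact integrable_dirac (by simp)
    rw [Multiset.map_cons, Multiset.sum_cons, Multiset.map_cons, Multiset.sum_cons,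
      FiniteMeasure.toMeasure_add]
    refine ⟨hi.add_measure ih.1, ?_⟩
    rw [integral_add_measure hi ih.1, ih.2, hy, integral_dirac]

theorem integral_zeroMeasure (f : ℂ → ℝ) (n : ℕ) (F : ℂ[X]) :
    ∫ z, f z ∂(zeroMeasure n F : Measure ℂ) = (n : ℝ)⁻¹ * (F.roots.map f).sum := by
  rw [zeroMeasure, FiniteMeasure.toMeasure_smul, integral_smul_nnreal_measure,
    (integral_multiset_sum_diracProba f _).2, NNReal.smul_def]
  simp

theorem integral_map_Uinv_equilibriumMeasure {b : ℂ} (hb : -(1 / 2) ≤ b.re) (hb' : b.re < 0)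
    {f : ℂ → ℝ} (hf : Continuous f) :
    ∫ z, f z ∂(equilibriumMeasure.map (Uinv b) : Measure ℂ) =
      Real.pi⁻¹ * ∫ θ in 0..Real.pi, f (arcPoint b (Real.cos θ)) := by
  have hμ : (equilibriumMeasure : Measure ℝ) = NNReal.pi⁻¹ • Polynomial.Chebyshev.measureT := rfl
  -- `Uinv` is controlled only on `[-1, 1]`, so its measurability is obtained almost everywhere.
  have hae : ∀ᵐ x ∂Polynomial.Chebyshev.measureT,
      Uinv b x = arcPoint b (Real.cos (Real.arccos x)) := by
    rw [Polynomial.Chebyshev.measureT]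
    refine (ae_restrict_mem measurableSet_Ioc).mono fun x hx => ?_
    rw [Real.cos_arccos hx.1.le hx.2, Uinv_eq_arcPoint hb hb' ⟨hx.1.le, hx.2⟩]
  have hm : AEMeasurable (Uinv b) (equilibriumMeasure : Measure ℝ) := by
    rw [hμ]
    refine AEMeasurable.smul_measure (AEMeasurable.congr ?_ (hae.mono fun x h => h.symm)) _
    exact ((continuous_arcPoint_cos hb hb').comp Real.continuous_arccos).measurable.aemeasurable
  rw [FiniteMeasure.toMeasure_map, integral_map hm hf.aestronglyMeasurable, hμ,
    integral_smul_nnreal_measure, Polynomial.Chebyshev.integral_measureT_eq_integral_cos,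
    NNReal.smul_def, smul_eq_mul]
  congr 1
  refine intervalIntegral.integral_congr fun θ _ => ?_
  exact congrArg f (Uinv_eq_arcPoint hb hb' ⟨Real.neg_one_le_cos θ, Real.cos_le_one θ⟩)

end

end Joukowski

theorem theorem4p1 (R θ : ℝ) (hR : 1 < R) (hθ : θ ∈ Set.Ioo (-(Real.pi / 2)) (Real.pi / 2))
    (hθ0 : θ ≠ 0) (h1 : 1 < R * Real.cos θ) (h2 : R * Real.cos θ ≤ 3 / 2)
    (Φ : ℂ → ℂ) (hΦ : Joukowski.IsExteriorMap (Joukowski.airfoil R θ) Φ)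
    (F : ℕ → ℂ[X]) (hF : ∀ n, Joukowski.IsFaberPolynomial Φ n (F n)) :
    -- `U` restricts to a bijection of the arc onto `[-1, 1]`, so that `U⁻¹` makes sense
    Set.BijOn (Joukowski.U (Joukowski.coeffB R θ)) (Joukowski.arc (Joukowski.coeffB R θ))
      ((fun x : ℝ => (x : ℂ)) '' Set.Icc (-1) 1) ∧
    -- all zeros of `F n` approach the arc
    (∀ ε > 0, ∀ᶠ n in atTop, ∀ z : ℂ, (F n).IsRoot z →
      z ∈ Metric.thickening ε (Joukowski.arc (Joukowski.coeffB R θ))) ∧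
    -- weak-* convergence to the push-forward of the equilibrium measure under `U⁻¹`
    Tendsto (fun n => Joukowski.zeroMeasure n (F n)) atTop
      (𝓝 (Joukowski.equilibriumMeasure.map (Joukowski.Uinv (Joukowski.coeffB R θ)))) := by
  have hre : (Joukowski.coeffB R θ).re = 1 - R * Real.cos θ := by
    rw [Joukowski.coeffB, Joukowski.coeffA, Complex.sub_re, Complex.re_ofReal_mul,
      Complex.exp_ofReal_mul_I_re, Complex.one_re]
  have hb : -(1 / 2) ≤ (Joukowski.coeffB R θ).re := by linarith
  have hb' : (Joukowski.coeffB R θ).re < 0 := by linarith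
  obtain ⟨ω, hω, hrot⟩ := hΦ.exists_rotation hb'
  have hFeq := fun n => (hF n).eq hb' hrot
  have ha0 : Joukowski.coeffA R θ ≠ 0 :=
    norm_pos_iff.1 ((norm_nonneg _).trans_lt (Joukowski.norm_coeffB_lt_norm_coeffA hb'))
  have hω0 : ω ≠ 0 := norm_pos_iff.1 (by rw [hω]; exact one_pos)
  have hroot : ∀ n z, (F n).IsRoot z ↔
      (Joukowski.rootPowerSum (Joukowski.coeffB R θ) n).eval z = (-Joukowski.coeffB R θ) ^ n := by
    intro n z
    rw [IsRoot, hFeq, eval_mul, eval_sub, eval_C, eval_C, mul_eq_zero, sub_eq_zero]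
    exact or_iff_right (pow_ne_zero n (div_ne_zero hω0 ha0))
  -- An upper bound on the number of zeros suffices: those found near the nodes already number
  -- nearly `n`.
  have hcard : ∀ n, (F n).roots.card ≤ n := by
    intro n
    refine (card_roots' _).trans ?_
    rw [hFeq]
    refine natDegree_C_mul_le _ _ |>.trans ((natDegree_sub_le _ _).trans (max_le ?_ ?_))
    · exact Joukowski.natDegree_rootPowerSum_le _ _
    · simp
  refine ⟨Joukowski.bijOn_U hb hb', fun ε hε => ?_, ?_⟩
  · filter_upwards [Joukowski.eventually_root_mem_thickening hb hb' hε] with n hn z hz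
    exact hn z ((hroot n z).1 hz)
  · have hne : ∀ n, F n ≠ 0 := fun n => Joukowski.IsFaberPolynomial.ne_zero hΦ (hF n)
    rw [FiniteMeasure.tendsto_iff_forall_integral_tendsto]
    intro f
    rw [Joukowski.integral_map_Uinv_equilibriumMeasure hb hb' f.continuous]
    simp_rw [Joukowski.integral_zeroMeasure]
    refine Joukowski.tendsto_average_roots hb hb' f.continuous (C := ‖f‖)
      (fun z => f.norm_coe_le_norm z) hcard ?_
    refine Eventually.of_forall fun n z hz => ?_
    exact (mem_roots (hne n)).2 ((hroot n z).2 hz)
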